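/- **Theorem 1.1.** For all $a_1, a_2, a_3, a_4 \in [0,\infty]$ with $a_1 \le a_2 \le a_3 \le a_4$ there is an ultrametric space $(X,d)$, homeomorphic to the Cantor set, such that $$\dim_H(X,d)=a_1,\qquad \dim_P(X,d)=a_2,\qquad \overline{\dim}_B(X,d)=a_3,\qquad \dim_A(X,d)=a_4 .$$ Here an ultrametric space is a metric space satisfying $d(x,y)\le\max\{d(x,z),d(z,y)\}$ for all $x,y,z\in X$. We write $B(x,r)$ for the closed ball of radius $r$ centered at $x$, and $N(Y,r)$ for the least cardinality of a set $A\subseteq Y$ such that the closed $r$-balls centered at points of $A$ cover $Y$. The dimensions are defined as follows. * $\dim_H(X,d)$ is the Hausdorff dimension. * $\dim_P(X,d)=\sup\{s\in[0,\infty) : \mathcal P^s(X)=\infty\}$ (with $\sup\emptyset=0$) is the packing dimension, where $\mathcal P^s$ is the radius-type packing measure $$\mathcal P^s(A)=\inf\Big\{\sum_{i=1}^\infty \widetilde{\mathcal P}^s_0(S_i) : A\subseteq\bigcup_{i=1}^{\infty} S_i\Big\},\qquad \widetilde{\mathcal P}^s_0(A)=\inf_{\delta>0}\,\sup \sum_i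 r_i^s ,$$ the last supremum being over all finite or countable families of points $x_i\in A$ and radii $r_i\in(0,\delta)$ for which the closed balls $B(x_i,r_i)\subseteq X$ are pairwise disjoint. * $\overline{\dim}_B(X,d)=\limsup_{r\to0+}\dfrac{\log N(X,r)}{-\log r}$ is the upper box dimension. * $\dim_A(X,d)$ is the Assouad dimension: the infimum of all $\lambda\in(0,\infty)$ for which there is $C\in(0,\infty)$ such that $N(B(x,R),r)\le C(R/r)^{\lambda}$ for all $x\in X$ and all $0<r<R<\infty$ (with $\inf\emptyset=\infty$). -/

import Mathlib

open MeasureTheory Filter Topology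
open scoped NNReal ENNReal

noncomputable section

/-- The quantity `P̃^s_δ(A)`: the supremum of `∑ i, (r i) ^ s` over all countable families of
radii `r i ∈ (0, δ)` and centres `x i ∈ A` such that the closed balls `B(x i, r i)` of the ambient
space are pairwise disjoint. The families are indexed by arbitrary sets `I` of natural numbers. -/
def packingPremeasureAt {X : Type*} [MetricSpace X] (s δ : ℝ≥0) (A : Set X) : ℝ≥0∞ :=
  ⨆ (I : Set ℕ) (x : ℕ → X) (r : ℕ → ℝ≥0) (_ : ∀ i ∈ I, x i ∈ A ∧ 0 < r i ∧ r i < δ)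
    (_ : I.PairwiseDisjoint fun i => Metric.closedBall (x i) (r i)),
    ∑' i : I, (r i : ℝ≥0∞) ^ (s : ℝ)

/-- The `s`-dimensional pre-packing measure (of radius type). -/
def packingPremeasure {X : Type*} [MetricSpace X] (s : ℝ≥0) (A : Set X) : ℝ≥0∞ :=
  ⨅ (δ : ℝ≥0) (_ : 0 < δ), packingPremeasureAt s δ A

/-- The `s`-dimensional packing measure (of radius type). -/
def packingMeasure {X : Type*} [MetricSpace X] (s : ℝ≥0) (A : Set X) : ℝ≥0∞ :=
  ⨅ (S : ℕ → Set X) (_ : A ⊆ ⋃ i, S i), ∑' i, packingPremeasure s (S i)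

/-- The packing dimension of a metric space, in `[0, ∞]`. -/
def packingDim (X : Type*) [MetricSpace X] : ℝ≥0∞ :=
  ⨆ (s : ℝ≥0) (_ : packingMeasure s (Set.univ : Set X) = ∞), (s : ℝ≥0∞)

/-- The upper box dimension of a metric space: the upper limit, as `r → 0+`, of
`log N(X, r) / (- log r)`, where `N(X, r)` is the least cardinality of an `r`-net of `X`
(that is, of a set of points whose closed `r`-balls cover `X`). -/
def upperBoxDim (X : Type*) [MetricSpace X] : EReal :=
  limsup (fun r : ℝ≥0 =>
    ENNReal.log (Metric.coveringNumber r (Set.univ : Set X) : ℝ≥0∞) /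
      ((-Real.log (r : ℝ) : ℝ) : EReal)) (𝓝[>] (0 : ℝ≥0))

/-- The Assouad dimension of a metric space, in `[0, ∞]`: the infimum of all exponents
`l ∈ (0, ∞)` such that, for some constant `C ∈ (0, ∞)`, every closed ball `B(x, R)` satisfies
`N(B(x, R), r) ≤ C (R / r) ^ l` for all `0 < r < R`. The nets of `B(x, R)` consist of points
of `B(x, R)`. -/
def assouadDim (X : Type*) [MetricSpace X] : ℝ≥0∞ :=
  ⨅ (l : ℝ≥0) (_ : 0 < l ∧ ∃ C : ℝ≥0, 0 < C ∧ ∀ (x : X) (R r : ℝ≥0), 0 < r → r < R →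
      (Metric.coveringNumber r (Metric.closedBall x (R : ℝ)) : ℝ≥0∞) ≤
        (C : ℝ≥0∞) * ((R : ℝ≥0∞) / (r : ℝ≥0∞)) ^ (l : ℝ)),
    (l : ℝ≥0∞)

end

open MeasureTheory Filter Topology
open scoped NNReal ENNReal

noncomputable section

/-! Give the boundary of the binary tree the distance 2^(-T), where T is the height of the node at
which two branches separate. A node at level m has 2^(n-m) descendants at level n, so dimensions
compare level differences n - m with s times height differences. Assouad dimension asks for this
between all levels of all branches. Box dimension starts at the root but is uniform in the branch.
Packing dimension allows constants depending on the branch, and Hausdorff dimension needs only a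
sequence of good levels.

An increment of about 1/a per level makes the tree look a-dimensional. In `fourDim`, the constant
branch `false` has local dimension 0, so its height grows quadratically. A branch leaving it at
level k meets k levels of dimension a₄: unboundedly many as k grows, hence seen by `assouadDim`, but
cheap against the height already gained. Next, dimension a₃ lasts up to level (k+2)^4. This
dominates everything below, so box dimension sees it, but it is only finitely long on each branch.
Finally a₁ and a₂ alternate in blocks [n, n³), each outweighing all before it, which separates
Hausdorff from packing dimension.

The upper bounds rest on `tsum_ofReal_rpow_le` and `dimH_le_of_forall_exists`; the lower bounds on
`le_dimH_univ`, `two_pow_le_coveringNumber` and `packingMeasure_univ_eq_top`. -/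

/-- A height function on the nodes of the infinite binary tree. The node at level `n` on the
branch `x` has height `T x n`; heights increase to infinity, uniformly, along the branches. -/
structure TreeHeight where
  T : (ℕ → Bool) → ℕ → ℝ
  zero : ∀ x, T x 0 = 0
  mono : ∀ x, Monotone (T x)
  congr : ∀ {x y n}, x ∈ PiNat.cylinder y n → T x n = T y n
  unbounded : ∀ C : ℝ, ∃ n, ∀ x, C ≤ T x n

/-! ### The ultrametric and the topology of the boundary. -/

namespace TreeHeight

variable (h : TreeHeight)

/-- The boundary of the binary tree, with the ultrametric given by a height function. -/
def Boundary (_ : TreeHeight) : Type := ℕ → Bool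

lemma nonneg (x : ℕ → Bool) (n : ℕ) : 0 ≤ h.T x n :=
  (h.zero x).symm.trans_le (h.mono x (Nat.zero_le n))

/-- The set of branches through the node at level `n` of the branch `x`. -/
abbrev cyl (x : h.Boundary) (n : ℕ) : Set h.Boundary := PiNat.cylinder (E := fun _ => Bool) x n

/-- The first level at which two branches differ. -/
abbrev diffLevel (x y : h.Boundary) : ℕ := PiNat.firstDiff (E := fun _ => Bool) x y

lemma mem_cyl_iff {x y : h.Boundary} (hxy : x ≠ y) {n : ℕ} : y ∈ h.cyl x n ↔ n ≤ h.diffLevel x y := by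
  exact (PiNat.mem_cylinder_comm (E := fun _ => Bool) x y n).trans
    (PiNat.mem_cylinder_iff_le_firstDiff (E := fun _ => Bool) hxy n)

open Classical in
/-- The distance between distinct branches is `2 ^ (-t)`, where `t` is the height of the node at
which they separate. -/
def treeDist (x y : h.Boundary) : ℝ := if x = y then 0 else 2 ^ (-h.T x (h.diffLevel x y))

variable {h}

lemma treeDist_self (x : h.Boundary) : h.treeDist x x = 0 := by simp [treeDist]

lemma treeDist_of_ne {x y : h.Boundary} (hxy : x ≠ y) :
    h.treeDist x y = 2 ^ (-h.T x (h.diffLevel x y)) := by simp [treeDist, hxy]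

lemma treeDist_le {x y : h.Boundary} {n : ℕ} (hy : y ∈ h.cyl x n) :
    h.treeDist x y ≤ 2 ^ (-h.T x n) := by
  by_cases hxy : x = y
  · subst hxy
    rw [treeDist_self]
    positivity
  · rw [treeDist_of_ne hxy]
    exact Real.rpow_le_rpow_of_exponent_le one_le_two
      (neg_le_neg (h.mono x ((h.mem_cyl_iff hxy).1 hy)))

lemma le_treeDist {x y : h.Boundary} {n : ℕ} (hy : y ∉ h.cyl x (n + 1)) :
    2 ^ (-h.T x n) ≤ h.treeDist x y := by
  have hxy : x ≠ y := by
    rintro rfl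
    exact hy (PiNat.self_mem_cylinder _ _)
  rw [treeDist_of_ne hxy]
  rw [h.mem_cyl_iff hxy, not_le] at hy
  exact Real.rpow_le_rpow_of_exponent_le one_le_two (neg_le_neg (h.mono x (by omega)))

lemma treeDist_nonneg (x y : h.Boundary) : 0 ≤ h.treeDist x y := by
  unfold treeDist
  split_ifs <;> positivity

lemma treeDist_comm (x y : h.Boundary) : h.treeDist x y = h.treeDist y x := by
  by_cases hxy : x = y
  · rw [hxy]
  · have hd : h.diffLevel x y = h.diffLevel y x := PiNat.firstDiff_comm (E := fun _ => Bool) x y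
    rw [treeDist_of_ne hxy, treeDist_of_ne (Ne.symm hxy), ← hd,
      h.congr (PiNat.mem_cylinder_firstDiff (E := fun _ => Bool) x y)]

/-- If both distances on the right were smaller, y would agree with x, and z with y, through the
level where x and z first differ. -/
lemma treeDist_triangle_max (x y z : h.Boundary) :
    h.treeDist x z ≤ max (h.treeDist x y) (h.treeDist y z) := by
  by_cases hxz : x = z
  · subst hxz
    rw [treeDist_self]
    exact le_max_of_le_left (treeDist_nonneg _ _)
  by_contra! hlt
  obtain ⟨h1, h2⟩ := max_lt_iff.1 hlt
  set n := h.diffLevel x z with hn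
  rw [treeDist_of_ne hxz, ← hn] at h1 h2
  have m1 : y ∈ h.cyl x (n + 1) := by
    by_contra hc
    exact absurd (le_treeDist hc) (not_le.2 h1)
  have hT : h.T x n = h.T y n :=
    (h.congr (PiNat.cylinder_anti (E := fun _ => Bool) x (Nat.le_succ n) m1)).symm
  have m2 : z ∈ h.cyl y (n + 1) := by
    by_contra hc
    exact absurd (le_treeDist hc) (not_le.2 (hT ▸ h2))
  have m3 : z ∈ h.cyl x (n + 1) := fun i hi => (m2 i hi).trans (m1 i hi)
  rw [h.mem_cyl_iff hxz] at m3
  omega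

instance : MetricSpace h.Boundary where
  dist := h.treeDist
  dist_self := treeDist_self
  dist_comm := treeDist_comm
  dist_triangle x y z := (treeDist_triangle_max x y z).trans
    (max_le_add_of_nonneg (treeDist_nonneg _ _) (treeDist_nonneg _ _))
  eq_of_dist_eq_zero {x y} hxy := by
    by_contra hne
    change h.treeDist x y = 0 at hxy
    rw [treeDist_of_ne hne] at hxy
    exact (Real.rpow_pos_of_pos two_pos _).ne' hxy

instance : IsUltrametricDist h.Boundary := ⟨treeDist_triangle_max⟩

lemma dist_le {x y : h.Boundary} {n : ℕ} (hy : y ∈ h.cyl x n) : dist x y ≤ 2 ^ (-h.T x n) :=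
  treeDist_le hy

lemma le_dist {x y : h.Boundary} {n : ℕ} (hy : y ∉ h.cyl x (n + 1)) :
    2 ^ (-h.T x n) ≤ dist x y :=
  le_treeDist hy

lemma mem_cyl_of_dist_lt {x y : h.Boundary} {n : ℕ} (hy : dist x y < 2 ^ (-h.T x n)) :
    y ∈ h.cyl x (n + 1) := by
  by_contra hc
  exact absurd (le_dist hc) (not_le.2 hy)

lemma cyl_subset_closedBall {x : h.Boundary} {n : ℕ} {r : ℝ} (hr : 2 ^ (-h.T x n) ≤ r) :
    h.cyl x n ⊆ Metric.closedBall x r := fun y hy => by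
  rw [Metric.mem_closedBall, dist_comm]
  exact (dist_le hy).trans hr

lemma exists_rpow_lt (h : TreeHeight) {r : ℝ} (hr : 0 < r) : ∃ n, ∀ x, (2 : ℝ) ^ (-h.T x n) < r := by
  obtain ⟨n, hn⟩ := h.unbounded (-Real.logb 2 r + 1)
  refine ⟨n, fun x => ?_⟩
  rw [← Real.lt_logb_iff_rpow_lt one_lt_two hr]
  linarith [hn x]

/-- The boundary is homeomorphic to the space of binary sequences. -/
def boundaryHomeo (h : TreeHeight) : (ℕ → Bool) ≃ₜ h.Boundary :=
  -- A continuous bijection from a compact space to a Hausdorff one is a homeomorphism, so only this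
  -- direction is checked.
  Continuous.homeoOfEquivCompactToT2 (f := (Equiv.refl (ℕ → Bool) : (ℕ → Bool) ≃ h.Boundary)) <| by
    rw [continuous_iff_continuousAt]
    intro x
    rw [ContinuousAt, Metric.tendsto_nhds]
    intro ε hε
    obtain ⟨n, hn⟩ := h.exists_rpow_lt hε
    filter_upwards [(PiNat.isOpen_cylinder (fun _ => Bool) x n).mem_nhds
      (PiNat.self_mem_cylinder x n)] with y hy
    rw [dist_comm]
    exact (dist_le (h := h) (x := x) (y := y) hy).trans_lt (hn x)

lemma isOpen_cyl (x : h.Boundary) (n : ℕ) : IsOpen (h.cyl x n) := by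
  rw [Metric.isOpen_iff]
  intro y hy
  refine ⟨2 ^ (-h.T y n), by positivity, fun z hz i hi => ?_⟩
  rw [Metric.mem_ball, dist_comm] at hz
  exact (mem_cyl_of_dist_lt hz i (by omega)).trans (hy i hi)

instance : CompactSpace h.Boundary := h.boundaryHomeo.compactSpace

instance : Nonempty h.Boundary := ⟨fun _ => false⟩

end TreeHeight

/-! ### Upper bounds for Assouad, box and packing dimension. -/

/-- **Kraft's inequality** for cylinders contained in a given cylinder. -/
lemma tsum_inv_two_pow_le_of_pairwise_disjoint_cylinder {ι : Type*}
    (x : ι → ℕ → Bool) (n : ι → ℕ) (y : ℕ → Bool) (m : ℕ)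
    (hd : Pairwise fun i j => Disjoint (PiNat.cylinder (x i) (n i)) (PiNat.cylinder (x j) (n j)))
    (hs : ∀ i, PiNat.cylinder (x i) (n i) ⊆ PiNat.cylinder y m) :
    ∑' i, (2⁻¹ : ℝ≥0∞) ^ n i ≤ 2⁻¹ ^ m := by
  -- Under the fair-coin measure a cylinder of level n has mass 2^(-n).
  let ν : Measure Bool := (PMF.uniformOfFintype Bool).toMeasure
  let μ : Measure (ℕ → Bool) := Measure.infinitePi fun _ => ν
  have hμ (x : ℕ → Bool) (n : ℕ) : μ (PiNat.cylinder x n) = 2⁻¹ ^ n := by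
    have : PiNat.cylinder x n = Set.pi (Finset.range n : Set ℕ) fun i => {x i} := by
      rw [PiNat.cylinder_eq_pi]
    rw [this]
    simp only [μ]
    rw [Measure.infinitePi_pi]
    · simp [ν]
    · simp
  rw [← hμ y m, ← tsum_congr fun i => hμ (x i) (n i)]
  exact (tsum_meas_le_meas_iUnion_of_disjoint μ
    (fun i => (PiNat.isOpen_cylinder (fun _ => Bool) _ _).measurableSet) hd).trans
    (measure_mono (Set.iUnion_subset hs))

namespace TreeHeight

variable {h : TreeHeight}

lemma ofReal_two_rpow_neg_natCast (n : ℕ) : ENNReal.ofReal (2 ^ (-(n : ℝ))) = 2⁻¹ ^ n := by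
  rw [Real.rpow_neg two_pos.le, Real.rpow_natCast, ENNReal.ofReal_inv_of_pos (by positivity),
    ENNReal.ofReal_pow two_pos.le, ENNReal.ofReal_ofNat, ENNReal.inv_pow]

/-- A closed ball contains a cylinder that is large if levels are controlled by heights. -/
lemma exists_cyl_subset_closedBall {x : h.Boundary} {m : ℕ} {s C : ℝ} (hs : 0 ≤ s)
    (hC : ∀ n, m ≤ n → (n : ℝ) - m ≤ s * (h.T x n - h.T x m) + C) {r : ℝ} (hr : 0 < r)
    (hrm : r ≤ 2 ^ (-h.T x m)) :
    ∃ n, m ≤ n ∧ h.cyl x n ⊆ Metric.closedBall x r ∧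
      (r * 2 ^ h.T x m) ^ s ≤ 2 ^ (C + 1 + m - n) := by
  classical
  have hC0 : 0 ≤ C := by simpa using hC m le_rfl
  have hex : ∃ n, m ≤ n ∧ (2 : ℝ) ^ (-h.T x n) ≤ r := by
    obtain ⟨n, hn⟩ := h.exists_rpow_lt hr
    refine ⟨max m n, le_max_left _ _, le_trans ?_ (hn x).le⟩
    exact Real.rpow_le_rpow_of_exponent_le one_le_two (neg_le_neg (h.mono x (le_max_right _ _)))
  -- The level n is the least one from m on whose cylinder has diameter bound at most r. If n > m,
  -- level n - 1 fails, which bounds r from above; this step back costs the +1 in the exponent.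
  obtain ⟨hmn, hn⟩ := Nat.find_spec hex
  set n := Nat.find hex with hndef
  refine ⟨n, hmn, cyl_subset_closedBall hn, ?_⟩
  rcases hmn.eq_or_lt with heq | hlt
  · rw [← heq]
    have h1 : r * 2 ^ h.T x m ≤ 1 := by
      calc r * 2 ^ h.T x m ≤ 2 ^ (-h.T x m) * 2 ^ h.T x m := by gcongr
        _ = 1 := by rw [← Real.rpow_add two_pos]; simp
    calc (r * 2 ^ h.T x m) ^ s ≤ 1 := Real.rpow_le_one (by positivity) h1 hs
      _ ≤ 2 ^ (C + 1 + m - m) := Real.one_le_rpow one_le_two (by linarith)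
  · obtain ⟨p, hp⟩ : ∃ p, n = p + 1 := ⟨n - 1, by omega⟩
    have hmp : m ≤ p := by omega
    have hpr : r < 2 ^ (-h.T x p) := by
      by_contra hc
      exact Nat.find_min hex (m := p) (by omega) ⟨hmp, not_lt.1 hc⟩
    have hCp := hC p hmp
    calc (r * 2 ^ h.T x m) ^ s ≤ (2 ^ (-h.T x p) * 2 ^ h.T x m) ^ s := by gcongr
      _ = 2 ^ (-(s * (h.T x p - h.T x m))) := by
        rw [← Real.rpow_add two_pos, ← Real.rpow_mul two_pos.le]
        congr 1
        ring
      _ ≤ 2 ^ (C + 1 + m - n) := by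
        apply Real.rpow_le_rpow_of_exponent_le one_le_two
        rw [hp]
        push_cast
        linarith

/-- The centres of disjoint balls contained in a cylinder satisfy a packing inequality. -/
lemma tsum_ofReal_rpow_le {ι : Type*} {z : h.Boundary} {m : ℕ} {s C : ℝ} (hs : 0 ≤ s)
    (x : ι → h.Boundary) (r : ι → ℝ) (hx : ∀ i, x i ∈ h.cyl z m)
    (hC : ∀ i n, m ≤ n → (n : ℝ) - m ≤ s * (h.T (x i) n - h.T (x i) m) + C) (hr : ∀ i, 0 < r i)
    (hrm : ∀ i, r i ≤ 2 ^ (-h.T z m))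
    (hd : Pairwise fun i j => Disjoint (Metric.closedBall (x i) (r i))
      (Metric.closedBall (x j) (r j))) :
    ∑' i, ENNReal.ofReal ((r i * 2 ^ h.T z m) ^ s) ≤ ENNReal.ofReal (2 ^ (C + 1)) := by
  have hT (i : ι) : h.T (x i) m = h.T z m := h.congr (hx i)
  choose n hmn hsub hle using fun i => exists_cyl_subset_closedBall hs (hC i) (hr i)
    (by rw [hT]; exact hrm i)
  have key := tsum_inv_two_pow_le_of_pairwise_disjoint_cylinder x n z m
    (fun i j hij => (hd hij).mono (hsub i) (hsub j))
    (fun i y hy k hk => (hy k (hk.trans_le (hmn i))).trans (hx i k hk))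
  have hle' (i : ι) : ENNReal.ofReal ((r i * 2 ^ h.T z m) ^ s) ≤
      ENNReal.ofReal (2 ^ (C + 1 + m)) * 2⁻¹ ^ n i := by
    rw [← ofReal_two_rpow_neg_natCast, ← ENNReal.ofReal_mul (by positivity),
      ← Real.rpow_add two_pos, ← sub_eq_add_neg, ← hT i]
    exact ENNReal.ofReal_le_ofReal (hle i)
  calc ∑' i, ENNReal.ofReal ((r i * 2 ^ h.T z m) ^ s)
      ≤ ∑' i, ENNReal.ofReal (2 ^ (C + 1 + m)) * 2⁻¹ ^ n i := ENNReal.tsum_le_tsum hle'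
    _ = ENNReal.ofReal (2 ^ (C + 1 + m)) * ∑' i, 2⁻¹ ^ n i := ENNReal.tsum_mul_left
    _ ≤ ENNReal.ofReal (2 ^ (C + 1 + m)) * 2⁻¹ ^ m := by gcongr
    _ = ENNReal.ofReal (2 ^ (C + 1)) := by
      rw [← ofReal_two_rpow_neg_natCast, ← ENNReal.ofReal_mul (by positivity),
        ← Real.rpow_add two_pos]
      congr 2
      ring

/-- Closed r-balls around r-separated points are disjoint in an ultrametric space, so the packing
inequality bounds the packing number, hence the covering number. -/
lemma coveringNumber_cyl_le_of_le {z : h.Boundary} {m : ℕ} {s C : ℝ} (hs : 0 ≤ s)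
    (hC : ∀ x ∈ h.cyl z m, ∀ n, m ≤ n → (n : ℝ) - m ≤ s * (h.T x n - h.T x m) + C) {r : ℝ≥0}
    (hr : 0 < r) (hrm : r ≤ (2 : ℝ) ^ (-h.T z m)) :
    (Metric.coveringNumber r (h.cyl z m) : ℝ≥0∞) ≤
      ENNReal.ofReal (2 ^ (C + 1) * (r * 2 ^ h.T z m) ^ (-s)) := by
  have hpk : Metric.coveringNumber r (h.cyl z m) ≤ Metric.packingNumber r (h.cyl z m) :=
    Metric.coveringNumber_le_packingNumber _ _
  refine (ENat.toENNReal_mono hpk).trans ?_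
  rw [Metric.packingNumber]
  simp only [ENat.toENNReal_iSup]
  refine iSup₂_le fun S hS => iSup_le fun hsep => ?_
  have hd : Pairwise fun i j : S => Disjoint (Metric.closedBall (i : h.Boundary) (r : ℝ))
      (Metric.closedBall (j : h.Boundary) (r : ℝ)) := by
    intro i j hij
    rw [Set.disjoint_left]
    intro w hi hj
    have h1 : (r : ℝ≥0∞) < edist (i : h.Boundary) j := hsep i.2 j.2 (fun hc => hij (Subtype.ext hc))
    rw [edist_nndist, ENNReal.coe_lt_coe, ← NNReal.coe_lt_coe, coe_nndist] at h1
    rw [Metric.mem_closedBall, dist_comm] at hi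
    rw [Metric.mem_closedBall] at hj
    exact absurd ((dist_triangle_max (i : h.Boundary) w j).trans (max_le hi hj)) (not_le.2 h1)
  have key := tsum_ofReal_rpow_le (z := z) (m := m) (C := C) hs (fun i : S => (i : h.Boundary))
    (fun _ => (r : ℝ)) (fun i => hS i.2) (fun i => hC i (hS i.2)) (fun _ => by exact_mod_cast hr)
    (fun _ => hrm) hd
  have hr' : (0 : ℝ) < r := by exact_mod_cast hr
  rw [ENNReal.tsum_set_const] at key
  rw [Real.rpow_neg (by positivity), ← div_eq_mul_inv, ENNReal.ofReal_div_of_pos (by positivity),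
    ENNReal.le_div_iff_mul_le]
  · exact key
  · left
    rw [← pos_iff_ne_zero]
    exact ENNReal.ofReal_pos.2 (by positivity)
  · left
    exact ENNReal.ofReal_ne_top

lemma T_zero (x : h.Boundary) : h.T x 0 = 0 := h.zero x

/-- The covering number of a cylinder whose levels are controlled by heights. -/
lemma coveringNumber_cyl_le {z : h.Boundary} {m : ℕ} {s C : ℝ} (hs : 0 ≤ s)
    (hC : ∀ x ∈ h.cyl z m, ∀ n, m ≤ n → (n : ℝ) - m ≤ s * (h.T x n - h.T x m) + C) {r R : ℝ≥0}
    (hr : 0 < r) (hrR : r ≤ R) (hR : (2 : ℝ) ^ (-h.T z m) ≤ R) :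
    (Metric.coveringNumber r (h.cyl z m) : ℝ≥0∞) ≤ ENNReal.ofReal (2 ^ (C + 1) * (R / r) ^ s) := by
  have hr' : (0 : ℝ) < r := by exact_mod_cast hr
  have hrR' : (r : ℝ) ≤ R := by exact_mod_cast hrR
  set ρ : ℝ≥0 := ⟨2 ^ (-h.T z m), by positivity⟩ with hρ
  have hρr : (ρ : ℝ) = 2 ^ (-h.T z m) := rfl
  have hρ0 : (0 : ℝ) < ρ := by rw [hρr]; positivity
  have hmul (t : ℝ) (ht : 0 < t) : (t * 2 ^ h.T z m) ^ (-s) = (ρ / t) ^ s := by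
    rw [hρr, Real.rpow_neg two_pos.le, Real.rpow_neg (by positivity), ← Real.inv_rpow (by positivity)]
    congr 1
    field_simp
  rcases le_total r ρ with hle | hle
  · refine (coveringNumber_cyl_le_of_le hs hC hr hle).trans (ENNReal.ofReal_le_ofReal ?_)
    rw [hmul _ hr', hρr]
    gcongr
  · refine (ENat.toENNReal_mono (Metric.coveringNumber_anti hle)).trans
      ((coveringNumber_cyl_le_of_le hs hC (by exact_mod_cast hρ0) hρr.le).trans
      (ENNReal.ofReal_le_ofReal ?_))
    rw [hmul _ hρ0, div_self hρ0.ne']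
    have : 1 ≤ (R : ℝ) / r := (one_le_div hr').2 hrR'
    gcongr

lemma exists_closedBall_eq_cyl (x : h.Boundary) {R : ℝ} (hR : 0 < R) :
    ∃ m, Metric.closedBall x R = h.cyl x m ∧ 2 ^ (-h.T x m) ≤ R := by
  classical
  have hex : ∃ n, (2 : ℝ) ^ (-h.T x n) ≤ R := by
    obtain ⟨n, hn⟩ := h.exists_rpow_lt hR
    exact ⟨n, (hn x).le⟩
  refine ⟨Nat.find hex, ?_, Nat.find_spec hex⟩
  refine Set.Subset.antisymm ?_ (cyl_subset_closedBall (Nat.find_spec hex))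
  intro y hy
  rcases Nat.eq_zero_or_pos (Nat.find hex) with h0 | hpos
  · rw [h0]
    exact fun i hi => absurd hi (Nat.not_lt_zero i)
  · obtain ⟨p, hp⟩ : ∃ p, Nat.find hex = p + 1 := ⟨Nat.find hex - 1, by omega⟩
    rw [hp]
    apply mem_cyl_of_dist_lt
    rw [Metric.mem_closedBall, dist_comm] at hy
    exact hy.trans_lt (not_le.1 (Nat.find_min hex (m := p) (by omega)))

lemma assouadDim_le {s : ℝ≥0} (hs : 0 < s) {C : ℝ}
    (hC : ∀ x (m n : ℕ), m ≤ n → (n : ℝ) - m ≤ s * (h.T x n - h.T x m) + C) :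
    assouadDim h.Boundary ≤ s := by
  refine iInf₂_le s ⟨hs, 2 ^ (C + 1), NNReal.rpow_pos two_pos, ?_⟩
  intro x R r hr hrR
  obtain ⟨m, hm, hmR⟩ := exists_closedBall_eq_cyl x (R := R) (by exact_mod_cast hr.trans hrR)
  rw [hm]
  refine (coveringNumber_cyl_le s.coe_nonneg (fun y _ => hC y m) hr hrR.le hmR).trans_eq ?_
  have hr' : (0 : ℝ) < r := by exact_mod_cast hr
  have hR' : (0 : ℝ) < R := by exact_mod_cast hr.trans hrR
  rw [ENNReal.ofReal_mul (by positivity), ← ENNReal.ofReal_rpow_of_pos (div_pos hR' hr'),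
    ENNReal.ofReal_div_of_pos hr', ENNReal.ofReal_coe_nnreal, ENNReal.ofReal_coe_nnreal]
  congr 1
  rw [← ENNReal.ofReal_coe_nnreal, NNReal.coe_rpow, NNReal.coe_ofNat]

lemma upperBoxDim_le {s : ℝ≥0} {C : ℝ} (hC : ∀ x (n : ℕ), (n : ℝ) ≤ s * h.T x n + C) :
    upperBoxDim h.Boundary ≤ ((s : ℝ) : EReal) := by
  have hlog : Tendsto (fun r : ℝ≥0 => -Real.log (r : ℝ)) (𝓝[>] 0) atTop := by
    rw [tendsto_neg_atTop_iff]
    refine Real.tendsto_log_nhdsGT_zero.comp (tendsto_nhdsWithin_iff.2 ⟨?_, ?_⟩)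
    · exact (NNReal.continuous_coe.tendsto' 0 0 rfl).mono_left nhdsWithin_le_nhds
    · filter_upwards [self_mem_nhdsWithin] with r hr
      exact_mod_cast hr
  have hlim : Tendsto (fun r : ℝ≥0 => (((C + 1) * Real.log 2 + s * -Real.log (r : ℝ)) /
      -Real.log (r : ℝ) : ℝ)) (𝓝[>] 0) (𝓝 (s : ℝ)) := by
    have h1 : Tendsto (fun r : ℝ≥0 => (C + 1) * Real.log 2 / -Real.log (r : ℝ) + s) (𝓝[>] 0)
        (𝓝 (0 + s)) := (hlog.const_div_atTop _).add_const _
    rw [zero_add] at h1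
    refine h1.congr' ?_
    filter_upwards [hlog.eventually_gt_atTop 0] with r hr
    rw [add_div, mul_div_cancel_right₀ _ hr.ne']
  rw [← (((continuous_coe_real_ereal.tendsto _).comp hlim)).limsup_eq]
  refine limsup_le_limsup ?_
  have hlt : ∀ᶠ r : ℝ≥0 in 𝓝[>] 0, r < 1 := nhdsWithin_le_nhds (gt_mem_nhds one_pos)
  filter_upwards [hlog.eventually_gt_atTop 0, self_mem_nhdsWithin, hlt] with r hr hr0 hr1
  rw [Function.comp, EReal.coe_div]
  refine EReal.div_le_div_right_of_nonneg (by exact_mod_cast hr.le) ?_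
  have hr' : (0 : ℝ) < r := by exact_mod_cast hr0
  let z : h.Boundary := fun _ => false
  have hz : (Set.univ : Set h.Boundary) = h.cyl z 0 := (PiNat.cylinder_zero _).symm
  have hcov := coveringNumber_cyl_le (z := z) (m := 0) (C := C) s.coe_nonneg
    (fun x _ n _ => by simpa [T_zero] using hC x n) (R := 1) hr0 hr1.le (by simp [T_zero])
  rw [← hz] at hcov
  refine (ENNReal.log_le_log hcov).trans_eq ?_
  rw [ENNReal.log_ofReal_of_pos (by positivity), Real.log_mul (by positivity) (by positivity),
    Real.log_rpow two_pos, Real.log_rpow (by positivity), NNReal.coe_one, one_div, Real.log_inv]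

/-- Splitting off r^(s'-s) ≤ δ^(s'-s) from each summand leaves the packing inequality for s; the
factor vanishes as δ tends to 0. -/
lemma packingPremeasureAt_le {s : ℝ≥0} {C : ℝ} {Y : Set h.Boundary}
    (hC : ∀ x ∈ Y, ∀ n : ℕ, (n : ℝ) ≤ s * h.T x n + C) {s' δ : ℝ≥0} (hs : s ≤ s') (hδ : δ ≤ 1) :
    packingPremeasureAt s' δ Y ≤
      (δ : ℝ≥0∞) ^ ((s' : ℝ) - s) * ENNReal.ofReal (2 ^ (C + 1)) := by
  have hs' : (s : ℝ) ≤ s' := by exact_mod_cast hs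
  refine iSup_le fun I => iSup_le fun x => iSup_le fun r => iSup_le fun hr => iSup_le fun hd => ?_
  let z : h.Boundary := fun _ => false
  have key := tsum_ofReal_rpow_le (z := z) (m := 0) (C := C) (s := s) s.coe_nonneg (fun i : I => x i)
    (fun i : I => (r i : ℝ)) (fun i k hk => absurd hk (Nat.not_lt_zero k))
    (fun i n _ => by simpa [T_zero] using hC (x i) (hr i i.2).1 n)
    (fun i => by exact_mod_cast (hr i i.2).2.1)
    (fun i => by simpa [T_zero] using (hr i i.2).2.2.le.trans hδ)
    (fun i j hij => hd i.2 j.2 (fun hc => hij (Subtype.ext hc)))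
  refine le_trans ?_ (mul_le_mul_right key _)
  rw [← ENNReal.tsum_mul_left]
  refine ENNReal.tsum_le_tsum fun i => ?_
  obtain ⟨-, hr0, hrδ⟩ := hr i i.2
  have hr0' : (0 : ℝ) < r i := by exact_mod_cast hr0
  rw [T_zero, Real.rpow_zero, mul_one, ← ENNReal.ofReal_rpow_of_pos hr0',
    ENNReal.ofReal_coe_nnreal]
  calc (r i : ℝ≥0∞) ^ (s' : ℝ) = (r i : ℝ≥0∞) ^ ((s' : ℝ) - s) * (r i : ℝ≥0∞) ^ (s : ℝ) := by
        rw [← ENNReal.rpow_add _ _ (by simpa using hr0.ne') ENNReal.coe_ne_top, sub_add_cancel]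
    _ ≤ _ := by
        gcongr

lemma packingPremeasure_eq_zero {s : ℝ≥0} {C : ℝ} {Y : Set h.Boundary}
    (hC : ∀ x ∈ Y, ∀ n : ℕ, (n : ℝ) ≤ s * h.T x n + C) {s' : ℝ≥0} (hs : s < s') :
    packingPremeasure s' Y = 0 := by
  have hpos : (0 : ℝ) < (s' : ℝ) - s := sub_pos.2 (by exact_mod_cast hs)
  have hlim : Tendsto (fun δ : ℝ≥0 => (δ : ℝ≥0∞) ^ ((s' : ℝ) - s) *
      ENNReal.ofReal (2 ^ (C + 1))) (𝓝[>] 0) (𝓝 0) := by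
    have h1 : Tendsto (fun δ : ℝ≥0 => (δ : ℝ≥0∞) ^ ((s' : ℝ) - s)) (𝓝 0) (𝓝 0) := by
      have := (ENNReal.continuous_rpow_const (y := (s' : ℝ) - s)).comp ENNReal.continuous_coe
      refine this.tendsto' 0 0 ?_
      simp [hpos]
    simpa using ENNReal.Tendsto.mul_const (h1.mono_left nhdsWithin_le_nhds)
      (Or.inr ENNReal.ofReal_ne_top)
  refine le_antisymm (ge_of_tendsto hlim ?_) zero_le
  filter_upwards [self_mem_nhdsWithin, nhdsWithin_le_nhds (gt_mem_nhds (one_pos (α := ℝ≥0)))]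
    with δ hδ hδ1
  exact (iInf₂_le δ hδ).trans (packingPremeasureAt_le hC hs.le (le_of_lt hδ1))

/-- The packing measure permits a countable decomposition, here by the size of C. Hence C may depend
on the branch. -/
lemma packingMeasure_univ_eq_zero {s : ℝ≥0}
    (hC : ∀ x, ∃ C : ℝ, ∀ n : ℕ, (n : ℝ) ≤ s * h.T x n + C) {s' : ℝ≥0} (hs : s < s') :
    packingMeasure s' (Set.univ : Set h.Boundary) = 0 := by
  refine le_antisymm ?_ zero_le
  refine (iInf₂_le (fun k : ℕ => {x : h.Boundary | ∀ n : ℕ, (n : ℝ) ≤ s * h.T x n + k}) ?_).trans ?_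
  · intro x _
    obtain ⟨C, hx⟩ := hC x
    obtain ⟨k, hk⟩ := exists_nat_ge C
    exact Set.mem_iUnion.2 ⟨k, fun n => (hx n).trans (by gcongr)⟩
  · refine (ENNReal.tsum_eq_zero.2 fun k => ?_).le
    exact packingPremeasure_eq_zero (Y := {x | ∀ n : ℕ, (n : ℝ) ≤ s * h.T x n + k})
      (fun x hx n => hx n) hs

lemma packingDim_le {s : ℝ≥0} (hC : ∀ x, ∃ C : ℝ, ∀ n : ℕ, (n : ℝ) ≤ s * h.T x n + C) :
    packingDim h.Boundary ≤ s := by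
  refine iSup₂_le fun s' hs' => ?_
  by_contra! hlt
  rw [packingMeasure_univ_eq_zero hC (by exact_mod_cast hlt)] at hs'
  exact ENNReal.zero_ne_top hs'

/-! ### Bounds for Hausdorff dimension. -/

/-- Covering Y by its 2^n traces on the cylinders of one good level n gives an s-sum of at most 1.
The term C serves only to make the diameters tend to 0. -/
lemma dimH_le_of_forall_exists {s : ℝ≥0} (hs : 0 < s) {Y : Set h.Boundary}
    (hY : ∀ C : ℝ, ∃ n : ℕ, ∀ y ∈ Y, n + C ≤ s * h.T y n) : dimH Y ≤ s := by
  have hs' : (0 : ℝ) < s := by exact_mod_cast hs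
  borelize h.Boundary
  choose n hn using fun j : ℕ => hY j
  apply dimH_le_of_hausdorffMeasure_ne_top
  let t (j : ℕ) (w : Fin (n j) → Bool) : Set h.Boundary := {y | y ∈ Y ∧ ∀ i : Fin (n j), y i = w i}
  have hdiam (j : ℕ) (w) : Metric.ediam (t j w) ≤ ENNReal.ofReal (2 ^ (-((n j + j) / s : ℝ))) := by
    refine Metric.ediam_le fun x hx y hy => ?_
    rw [edist_dist]
    refine ENNReal.ofReal_le_ofReal ((dist_le (n := n j) ?_).trans ?_)
    · intro i hi
      exact (hy.2 ⟨i, hi⟩).trans (hx.2 ⟨i, hi⟩).symm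
    · refine Real.rpow_le_rpow_of_exponent_le one_le_two (neg_le_neg ?_)
      rw [div_le_iff₀' hs']
      exact hn j x hx.1
  have hr : Tendsto (fun j : ℕ => ENNReal.ofReal (2 ^ (-((j : ℝ) / s)))) atTop (𝓝 0) := by
    rw [← ENNReal.ofReal_zero]
    refine ENNReal.tendsto_ofReal ?_
    refine (tendsto_rpow_atBot_of_base_gt_one 2 one_lt_two).comp (tendsto_neg_atTop_atBot.comp ?_)
    exact tendsto_natCast_atTop_atTop.atTop_div_const hs'
  have hle := Measure.hausdorffMeasure_le_liminf_sum (s : ℝ) Y _ hr t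
    (Eventually.of_forall fun j w => (hdiam j w).trans <| ENNReal.ofReal_le_ofReal <|
      Real.rpow_le_rpow_of_exponent_le one_le_two <| neg_le_neg <| by gcongr; simp)
    (Eventually.of_forall fun j y hy => Set.mem_iUnion.2 ⟨fun i => y i, hy, fun _ => rfl⟩)
  refine (hle.trans ?_).trans_lt ENNReal.one_lt_top |>.ne
  refine liminf_le_of_le (by isBoundedDefault) fun b hb => ?_
  obtain ⟨j, hj⟩ := hb.exists
  refine hj.trans ?_
  calc ∑ w, Metric.ediam (t j w) ^ (s : ℝ)
      ≤ ∑ w : Fin (n j) → Bool, (2⁻¹ ^ (n j) : ℝ≥0∞) := by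
        refine Finset.sum_le_sum fun w _ => ?_
        rw [← ofReal_two_rpow_neg_natCast]
        refine (ENNReal.rpow_le_rpow (hdiam j w) hs'.le).trans ?_
        rw [ENNReal.ofReal_rpow_of_pos (by positivity), ← Real.rpow_mul two_pos.le]
        refine ENNReal.ofReal_le_ofReal (Real.rpow_le_rpow_of_exponent_le one_le_two ?_)
        field_simp
        simp
    _ = 1 := by
        simp [← mul_pow, ENNReal.mul_inv_cancel]

lemma dimH_univ_le {s : ℝ≥0} (hs : 0 < s) (Y : ℕ → Set h.Boundary) (hU : ⋃ k, Y k = Set.univ)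
    (hY : ∀ k, ∀ C : ℝ, ∃ n : ℕ, ∀ y ∈ Y k, n + C ≤ s * h.T y n) :
    dimH (Set.univ : Set h.Boundary) ≤ s := by
  rw [← hU, dimH_iUnion]
  exact iSup_le fun k => dimH_le_of_forall_exists hs (hY k)

/-- The real number in `[0, 1]` whose binary digits are given by a branch. -/
def binaryValue (x : h.Boundary) : ℝ := Real.ofDigits fun i => (if x i then 1 else 0 : Fin 2)

lemma exists_binaryValue_eq {t : ℝ} (ht : t ∈ Set.Icc (0 : ℝ) 1) :
    ∃ x : h.Boundary, binaryValue x = t := by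
  obtain ⟨d, -, rfl⟩ := Real.ofDigits_SurjOn one_lt_two ht
  refine ⟨fun i => decide (d i = 1), ?_⟩
  refine congrArg Real.ofDigits (funext fun i => ?_)
  have key : ∀ a : Fin 2, (if decide (a = 1) = true then (1 : Fin 2) else 0) = a := by decide
  exact key (d i)

lemma abs_binaryValue_sub_le {x y : h.Boundary} {n : ℕ} (hxy : y ∈ h.cyl x n) :
    |binaryValue x - binaryValue y| ≤ (2 ^ n)⁻¹ := by
  have := Real.abs_ofDigits_sub_ofDigits_le (b := 2) (n := n)
    (x := fun i => if x i then 1 else 0) (y := fun i => if y i then 1 else 0)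
    (fun i hi => by simp only [hxy i hi])
  rwa [Nat.cast_ofNat] at this

lemma holderOnWith_binaryValue {s : ℝ≥0} {C : ℝ} {Y : Set h.Boundary}
    (hC : ∀ x ∈ Y, ∀ n : ℕ, s * h.T x n ≤ n + C) :
    HolderOnWith (2 ^ C) s binaryValue Y := by
  intro x hx y _
  by_cases hxy : x = y
  · simp [hxy]
  have hmem : y ∈ h.cyl x (h.diffLevel x y) := (h.mem_cyl_iff hxy).2 le_rfl
  have hdist : dist x y = 2 ^ (-h.T x (h.diffLevel x y)) := treeDist_of_ne hxy
  have hpos : 0 < dist x y := dist_pos.2 hxy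
  rw [edist_dist, edist_dist, ENNReal.ofReal_rpow_of_pos hpos, ← ENNReal.ofReal_coe_nnreal,
    ← ENNReal.ofReal_mul (by positivity), NNReal.coe_rpow, NNReal.coe_ofNat, hdist,
    ← Real.rpow_mul two_pos.le, ← Real.rpow_add two_pos]
  refine ENNReal.ofReal_le_ofReal ((abs_binaryValue_sub_le hmem).trans ?_)
  rw [← Real.rpow_natCast, ← Real.rpow_neg two_pos.le]
  refine Real.rpow_le_rpow_of_exponent_le one_le_two ?_
  linarith [hC x hx (h.diffLevel x y)]

/-- Binary expansion maps the boundary onto [0,1] and is s-Hölder on countably many sets covering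
all but countably many branches. Hence 1 is at most the dimension of the boundary divided by s. -/
lemma le_dimH_univ {s : ℝ≥0} (hs : 0 < s)
    (hC : {x | ¬ ∃ C : ℝ, ∀ n : ℕ, s * h.T x n ≤ n + C}.Countable) :
    s ≤ dimH (Set.univ : Set h.Boundary) := by
  have hs' : (s : ℝ≥0∞) ≠ 0 := by exact_mod_cast hs.ne'
  let Y (k : ℕ) : Set h.Boundary := {x | ∀ n : ℕ, s * h.T x n ≤ n + (k : ℝ)}
  let Z : Set h.Boundary := {x | ¬ ∃ C : ℝ, ∀ n : ℕ, s * h.T x n ≤ n + C}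
  have hZ : Z.Countable := hC
  have hsub : Set.Icc (0 : ℝ) 1 ⊆ binaryValue '' Z ∪ ⋃ k, binaryValue '' Y k := by
    intro t ht
    obtain ⟨x, rfl⟩ := exists_binaryValue_eq (h := h) ht
    by_cases hx : x ∈ Z
    · exact Or.inl ⟨x, hx, rfl⟩
    · obtain ⟨C, hx⟩ := not_not.1 hx
      obtain ⟨k, hk⟩ := exists_nat_ge C
      exact Or.inr (Set.mem_iUnion.2 ⟨k, x, fun n => (hx n).trans (by gcongr), rfl⟩)
  have h1 : dimH (Set.Icc (0 : ℝ) 1) = 1 := by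
    rw [Real.dimH_of_nonempty_interior (by simp)]
    simp
  have h2 := dimH_mono hsub
  rw [h1, dimH_union, dimH_countable (hZ.image _), dimH_iUnion, max_eq_right zero_le] at h2
  have h3 : (1 : ℝ≥0∞) ≤ dimH (Set.univ : Set h.Boundary) / s := by
    refine h2.trans (iSup_le fun k => ?_)
    refine ((holderOnWith_binaryValue (Y := Y k) (C := k) fun x hx n => hx n).dimH_image_le
      hs).trans ?_
    gcongr
    exact Set.subset_univ _
  rwa [ENNReal.le_div_iff_mul_le (Or.inl hs') (Or.inl ENNReal.coe_ne_top), one_mul] at h3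

/-! ### Lower bounds for box, Assouad and packing dimension. -/

/-- The words of length `j` give nodes `j` levels above a given node. -/
lemma exists_words (z : h.Boundary) (m j : ℕ) :
    ∃ b : (Fin j → Bool) → h.Boundary, (∀ w, b w ∈ h.cyl z m) ∧
      ∀ w w', w ≠ w' → ∀ p ∈ h.cyl (b w) (m + j), ∀ q ∈ h.cyl (b w') (m + j),
        q ∉ h.cyl p (m + j) := by
  refine ⟨fun w i => if i < m then z i else if hi : i - m < j then w ⟨i - m, hi⟩ else false,
    fun w i hi => by simp [hi], ?_⟩
  intro w w' hw p hp q hq hqp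
  apply hw
  ext i
  have hi : m + (i : ℕ) < m + j := by omega
  have := ((hp _ hi).symm.trans (hqp _ hi).symm).trans (hq _ hi)
  simpa using this

lemma le_dist_of_notMem_cyl {x y : h.Boundary} {n : ℕ} {t : ℝ} (hy : y ∉ h.cyl x n)
    (ht : h.T x n ≤ t) : 2 ^ (-t) ≤ dist x y := by
  refine le_trans ?_ (le_dist (n := n) fun hc =>
    hy (PiNat.cylinder_anti (E := fun _ => Bool) x n.le_succ hc))
  exact Real.rpow_le_rpow_of_exponent_le one_le_two (neg_le_neg ht)

lemma two_pow_le_coveringNumber {z : h.Boundary} {m n : ℕ} (hmn : m ≤ n) {t : ℝ}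
    (ht : ∀ y ∈ h.cyl z m, h.T y n ≤ t) {A : Set h.Boundary} (hA : h.cyl z m ⊆ A) :
    (2 : ℝ≥0∞) ^ (n - m) ≤ Metric.coveringNumber (2 ^ (-(t + 2))) A := by
  obtain ⟨b, hb, hsep⟩ := exists_words z m (n - m)
  rw [Nat.add_sub_cancel' hmn] at hsep
  have hself (w) : b w ∈ h.cyl (b w) n := PiNat.self_mem_cylinder _ _
  have hinj : Function.Injective b := by
    intro w w' hww
    by_contra hne
    refine hsep w w' hne _ (hself w) _ (hself w') ?_
    rw [hww]
    exact hself w'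
  have hS : Metric.IsSeparated ((2 * 2 ^ (-(t + 2)) : ℝ≥0) : ℝ≥0∞) (Set.range b) := by
    rintro _ ⟨w, rfl⟩ _ ⟨w', rfl⟩ hne
    have h1 := le_dist_of_notMem_cyl (hsep w w' (fun hc => hne (congrArg b hc)) _ (hself w) _
      (hself w')) (ht _ (hb w))
    change (_ : ℝ≥0∞) < edist (b w) (b w')
    rw [edist_nndist, ENNReal.coe_lt_coe, ← NNReal.coe_lt_coe, coe_nndist]
    refine lt_of_lt_of_le ?_ h1
    rw [NNReal.coe_mul, NNReal.coe_rpow, NNReal.coe_ofNat]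
    have : (2 : ℝ) * 2 ^ (-(t + 2)) = 2 ^ (-t - 1) := by
      nth_rewrite 1 [← Real.rpow_one 2]
      rw [← Real.rpow_add two_pos]
      congr 1
      ring
    rw [this]
    exact Real.rpow_lt_rpow_of_exponent_lt one_lt_two (by linarith)
  have hcard : (Set.range b).encard = (2 ^ (n - m) : ℕ) := by
    rw [← Set.image_univ, hinj.encard_image, Set.encard_univ, ENat.card_eq_coe_fintype_card]
    simp
  -- The chain passes through external covering numbers because these, unlike internal ones, are
  -- monotone in the set. Twice the radius is 2^(-t-1), strictly below the separation 2^(-t).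
  have h1 := (hS.encard_le_packingNumber (A := h.cyl z m) (by rintro _ ⟨w, rfl⟩; exact hb w)).trans
    ((Metric.packingNumber_two_mul_le_externalCoveringNumber _ _).trans
    ((Metric.externalCoveringNumber_mono_set hA).trans
    (Metric.externalCoveringNumber_le_coveringNumber _ _)))
  rw [hcard] at h1
  have h2 := ENat.toENNReal_mono h1
  simpa using h2

lemma le_upperBoxDim {s : ℝ≥0}
    (hC : ∀ C : ℝ, ∃ (x : h.Boundary) (m n : ℕ) (t : ℝ), m ≤ n ∧ (∀ y ∈ h.cyl x m, h.T y n ≤ t) ∧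
      s * t + C ≤ n - m) :
    ((s : ℝ) : EReal) ≤ upperBoxDim h.Boundary := by
  refine le_limsup_of_frequently_le ?_
  rw [frequently_iff]
  intro U hU
  obtain ⟨ε, hε, hεU⟩ := mem_nhdsGT_iff_exists_Ioo_subset.1 hU
  have hε' : (0 : ℝ) < ε := by exact_mod_cast hε
  obtain ⟨N, hN⟩ := h.exists_rpow_lt hε'
  -- N forces n ≥ N, so that the radius is below ε; 2s absorbs the shift from t to t + 2.
  obtain ⟨x, m, n, t, hmn, ht, hst⟩ := hC (max N (2 * s))
  have hxt : h.T x n ≤ t := ht x (PiNat.self_mem_cylinder _ _)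
  have ht0 : 0 ≤ t := (h.nonneg x n).trans hxt
  have hNn : N ≤ n := by
    have h1 := le_max_left (N : ℝ) (2 * s)
    have h2 : 0 ≤ s * t := mul_nonneg s.coe_nonneg ht0
    have : (N : ℝ) ≤ n := by linarith [(Nat.cast_nonneg m : (0 : ℝ) ≤ m)]
    exact_mod_cast this
  refine ⟨2 ^ (-(t + 2)), hεU ⟨NNReal.rpow_pos two_pos, ?_⟩, ?_⟩
  · rw [← NNReal.coe_lt_coe, NNReal.coe_rpow, NNReal.coe_ofNat]
    refine lt_of_le_of_lt ?_ (hN x)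
    refine Real.rpow_le_rpow_of_exponent_le one_le_two ?_
    linarith [h.mono x hNn]
  · have hlog2 : 0 < Real.log 2 := Real.log_pos one_lt_two
    rw [NNReal.coe_rpow, NNReal.coe_ofNat, Real.log_rpow two_pos, neg_mul, neg_neg]
    have hpos : 0 < (t + 2) * Real.log 2 := by positivity
    rw [EReal.le_div_iff_mul_le (by exact_mod_cast hpos) (EReal.coe_ne_top _)]
    refine le_trans ?_ (ENNReal.log_le_log
      (two_pow_le_coveringNumber hmn ht (Set.subset_univ _)))
    have h2 : (2 : ℝ≥0∞) ^ (n - m) = ENNReal.ofReal (2 ^ (n - m)) := by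
      rw [ENNReal.ofReal_pow two_pos.le, ENNReal.ofReal_ofNat]
    rw [h2, ENNReal.log_ofReal_of_pos (by positivity), Real.log_pow, Nat.cast_sub hmn]
    rw [← EReal.coe_mul, EReal.coe_le_coe_iff, ← mul_assoc]
    have := le_max_right (N : ℝ) (2 * s)
    refine mul_le_mul_of_nonneg_right ?_ hlog2.le
    linarith

lemma le_assouadDim {s : ℝ≥0}
    (hC : ∀ C : ℝ, ∃ (x : h.Boundary) (m n : ℕ) (t : ℝ), m ≤ n ∧ 0 ≤ t ∧
      (∀ y ∈ h.cyl x m, h.T y n ≤ h.T x m + t) ∧ s * t + C ≤ n - m) :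
    s ≤ assouadDim h.Boundary := by
  refine le_iInf₂ fun l hl => ?_
  obtain ⟨-, C, hC0, hcov⟩ := hl
  by_contra! hlt
  have hls : (l : ℝ) ≤ s := by exact_mod_cast hlt.le
  have hC0' : (0 : ℝ) < C := by exact_mod_cast hC0
  -- The terms absorb the constant C and the shift t + 2 in the radius; the final 1 makes the
  -- contradiction strict.
  obtain ⟨x, m, n, t, hmn, ht0, ht, hst⟩ := hC (Real.logb 2 C + 2 * l + 1)
  have h1 := two_pow_le_coveringNumber hmn ht
    (cyl_subset_closedBall (x := x) (r := ((2 ^ (-h.T x m) : ℝ≥0) : ℝ)) (by simp))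
  have h2 := h1.trans (hcov x (2 ^ (-h.T x m)) _ (NNReal.rpow_pos two_pos)
    (NNReal.rpow_lt_rpow_of_exponent_lt one_lt_two (by linarith)))
  rw [← ENNReal.coe_div (NNReal.rpow_pos two_pos).ne', ← NNReal.rpow_sub two_ne_zero,
    ← ENNReal.coe_rpow_of_nonneg _ l.coe_nonneg, ← ENNReal.coe_mul, ← NNReal.rpow_mul] at h2
  have h3 : (2 : ℝ) ^ (n - m) ≤ C * 2 ^ ((-h.T x m - -(h.T x m + t + 2)) * l) := by
    rw [← ENNReal.coe_ofNat, ← ENNReal.coe_pow, ENNReal.coe_le_coe] at h2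
    exact_mod_cast h2
  rw [← Real.rpow_natCast, Nat.cast_sub hmn] at h3
  have h4 : (C : ℝ) = 2 ^ Real.logb 2 C := (Real.rpow_logb two_pos (by norm_num) hC0').symm
  rw [h4, ← Real.rpow_add two_pos, Real.rpow_le_rpow_left_iff one_lt_two] at h3
  have h5 : l * t ≤ s * t := mul_le_mul_of_nonneg_right hls ht0
  nlinarith

lemma card_mul_rpow_le_packingPremeasureAt {X : Type*} [MetricSpace X] [IsUltrametricDist X]
    {ι : Type*} [Fintype ι] {A : Set X} {s δ r : ℝ≥0} (hr : 0 < r) (hrδ : r < δ) (p : ι → X)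
    (hp : ∀ i, p i ∈ A) (hsep : ∀ i j, i ≠ j → r < dist (p i) (p j)) :
    Fintype.card ι * (r : ℝ≥0∞) ^ (s : ℝ) ≤ packingPremeasureAt s δ A := by
  rcases isEmpty_or_nonempty ι with he | ⟨⟨i₀⟩⟩
  · simp
  let e := Fintype.equivFin ι
  let x (k : ℕ) : X := if hk : k < Fintype.card ι then p (e.symm ⟨k, hk⟩) else p i₀
  have hx (k : ℕ) (hk : k < Fintype.card ι) : x k = p (e.symm ⟨k, hk⟩) := by simp [x, hk]
  refine le_iSup_of_le (Set.Iio (Fintype.card ι)) <| le_iSup_of_le x <|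
    le_iSup_of_le (fun _ => r) <| le_iSup_of_le (fun k hk => ?_) <|
    le_iSup_of_le (fun k hk l hl hkl => ?_) ?_
  · rw [hx k hk]
    exact ⟨hp _, hr, hrδ⟩
  · rw [Function.onFun, hx k hk, hx l hl, Set.disjoint_left]
    intro w hw hw'
    have h1 := hsep (e.symm ⟨k, hk⟩) (e.symm ⟨l, hl⟩) (fun hc => hkl (congrArg Fin.val (e.symm.injective hc)))
    rw [Metric.mem_closedBall, dist_comm] at hw
    rw [Metric.mem_closedBall] at hw'
    exact absurd ((dist_triangle_max _ w _).trans (max_le hw hw')) (not_le.2 h1)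
  · rw [ENNReal.tsum_set_const]
    gcongr
    simp [Set.encard, ENat.card_eq_coe_fintype_card]

/-- By Baire's theorem, some set of any countable cover is dense in a cylinder inside the given one.
It then contains as many separated points as that cylinder has nodes at level n, and equal balls
around them make the premeasure infinite. -/
lemma packingMeasure_univ_eq_top {s : ℝ≥0} (z₀ : h.Boundary) (m₀ : ℕ)
    (hC : ∀ C : ℝ, ∃ (n : ℕ) (t : ℝ), (∀ y ∈ h.cyl z₀ m₀, h.T y n ≤ t) ∧ s * t + C ≤ n) :
    packingMeasure s (Set.univ : Set h.Boundary) = ∞ := by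
  refine top_le_iff.1 (le_iInf₂ fun S hS => ?_)
  have hdense := dense_iUnion_interior_of_closed (f := fun i => closure (S i))
    (fun i => isClosed_closure) (Set.univ_subset_iff.1 (hS.trans (Set.iUnion_mono fun i =>
      subset_closure)))
  obtain ⟨z, hz, hz'⟩ := hdense.inter_open_nonempty _ (isOpen_cyl z₀ m₀)
    ⟨z₀, PiNat.self_mem_cylinder _ _⟩
  obtain ⟨i, hi⟩ := Set.mem_iUnion.1 hz'
  refine le_trans ?_ (ENNReal.le_tsum i)
  obtain ⟨ε, hε, hball⟩ := Metric.isOpen_iff.1 isOpen_interior z hi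
  obtain ⟨m₁, hm₁⟩ := h.exists_rpow_lt hε
  set m := max m₀ m₁ with hm
  have hcyl : h.cyl z m ⊆ closure (S i) := by
    intro y hy
    refine interior_subset (hball ?_)
    rw [Metric.mem_ball, dist_comm]
    exact (dist_le (PiNat.cylinder_anti (E := fun _ => Bool) z (le_max_right _ _) hy)).trans_lt
      (hm₁ z)
  have hcyl₀ : h.cyl z m ⊆ h.cyl z₀ m₀ := fun y hy k hk =>
    (hy k (hk.trans_le (le_max_left _ _))).trans (hz k hk)
  refine le_iInf₂ fun δ hδ => ?_
  refine ENNReal.le_of_forall_nnreal_lt fun K _ => ?_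
  obtain ⟨N, hN⟩ := h.exists_rpow_lt (r := δ) (by exact_mod_cast hδ)
  -- The level m is known only after Baire's theorem, but C is arbitrary and can absorb it, along
  -- with the radius shift s and the target K.
  obtain ⟨n, t, ht, hst⟩ := hC (max N (m + s + Real.logb 2 (K + 1)))
  have hzt : h.T z n ≤ t := ht z hz
  have hst0 : 0 ≤ s * t := mul_nonneg s.coe_nonneg ((h.nonneg z n).trans hzt)
  have hNn : N ≤ n := by
    have := le_max_left (N : ℝ) (m + s + Real.logb 2 (K + 1))
    have : (N : ℝ) ≤ n := by linarith
    exact_mod_cast this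
  have hmK := le_max_right (N : ℝ) (m + s + Real.logb 2 (K + 1))
  have hK : 0 ≤ Real.logb 2 ((K : ℝ) + 1) :=
    Real.logb_nonneg one_lt_two (by linarith [K.coe_nonneg])
  have hmn : m ≤ n := by
    have : (m : ℝ) ≤ n := by linarith [s.coe_nonneg]
    exact_mod_cast this
  obtain ⟨b, hb, hsep⟩ := exists_words z m (n - m)
  rw [Nat.add_sub_cancel' hmn] at hsep
  have hex (w) : ∃ p, p ∈ h.cyl (b w) n ∧ p ∈ S i :=
    mem_closure_iff.1 (hcyl (hb w)) _ (isOpen_cyl _ _) (PiNat.self_mem_cylinder _ _)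
  choose p hp hpS using hex
  have hpz (w) : p w ∈ h.cyl z m := fun k hk => (hp w k (hk.trans_le hmn)).trans (hb w k hk)
  have key := card_mul_rpow_le_packingPremeasureAt (A := S i) (s := s) (δ := δ)
    (r := 2 ^ (-(t + 1))) (NNReal.rpow_pos two_pos) ?_ p hpS ?_
  · refine le_trans ?_ key
    rw [← ENNReal.coe_rpow_of_nonneg _ s.coe_nonneg, ← NNReal.rpow_mul]
    simp only [Fintype.card_pi, Fintype.card_bool, Finset.prod_const, Finset.card_univ,
      Fintype.card_fin]
    rw [← ENNReal.coe_natCast, ← ENNReal.coe_mul, ENNReal.coe_le_coe, ← NNReal.coe_le_coe]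
    push_cast
    rw [← Real.rpow_natCast, Nat.cast_sub hmn, ← Real.rpow_add two_pos]
    calc (K : ℝ) ≤ K + 1 := by linarith
      _ = 2 ^ Real.logb 2 (K + 1) := (Real.rpow_logb two_pos (by norm_num) (by positivity)).symm
      _ ≤ _ := Real.rpow_le_rpow_of_exponent_le one_le_two (by nlinarith)
  · rw [← NNReal.coe_lt_coe, NNReal.coe_rpow, NNReal.coe_ofNat]
    refine lt_of_le_of_lt ?_ (hN z)
    refine Real.rpow_le_rpow_of_exponent_le one_le_two ?_
    linarith [h.mono z hNn]
  · intro w w' hww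
    refine lt_of_lt_of_le ?_ (le_dist_of_notMem_cyl (hsep w w' hww _ (hp w) _ (hp w'))
      (ht _ (hcyl₀ (hpz w))))
    rw [NNReal.coe_rpow, NNReal.coe_ofNat]
    exact Real.rpow_lt_rpow_of_exponent_lt one_lt_two (by linarith)

end TreeHeight

/-! ### Heights from local dimensions. -/

namespace TreeHeight

/-- The increase of the height at level `n` that makes the tree look `a`-dimensional. -/
def increment (a : ℝ≥0∞) (n : ℕ) : ℝ := (min a⁻¹ n).toReal + 1 / (n + 1)

/-- The harmonic summand keeps heights unbounded even where a = ∞. -/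
lemma one_div_le_increment (a : ℝ≥0∞) (n : ℕ) : 1 / ((n : ℝ) + 1) ≤ increment a n :=
  le_add_of_nonneg_left ENNReal.toReal_nonneg

lemma increment_pos (a : ℝ≥0∞) (n : ℕ) : 0 < increment a n :=
  lt_of_lt_of_le (by positivity) (one_div_le_increment a n)

lemma increment_le (a : ℝ≥0∞) (n : ℕ) : increment a n ≤ n + 1 := by
  refine add_le_add ?_ ?_
  · simpa using ENNReal.toReal_mono (ENNReal.natCast_ne_top n) (min_le_right a⁻¹ n)
  · rw [div_le_one (by positivity)]
    simp

lemma increment_anti {a b : ℝ≥0∞} (hab : a ≤ b) (n : ℕ) : increment b n ≤ increment a n := by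
  refine add_le_add_left (ENNReal.toReal_mono (ne_top_of_le_ne_top (ENNReal.natCast_ne_top n)
    (min_le_right a⁻¹ n)) ?_) _
  gcongr

/-- Truncating a⁻¹ at n keeps increments finite, yet for a = 0 they still grow linearly and heights
quadratically. -/
lemma le_increment_zero (n : ℕ) : (n : ℝ) ≤ increment 0 n := by
  simp only [increment, ENNReal.inv_zero, min_eq_right le_top, ENNReal.toReal_natCast]
  exact le_add_of_nonneg_right (by positivity)

lemma eventually_one_le_mul_increment {a : ℝ≥0∞} {s : ℝ≥0} (h : a < s) :
    ∃ M : ℕ, ∀ n, M ≤ n → 1 ≤ s * increment a n := by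
  have hs : 0 < s := by exact_mod_cast (zero_le (a := a)).trans_lt h
  have hs' : (0 : ℝ) < s := by exact_mod_cast hs
  obtain ⟨M, hM⟩ := exists_nat_ge (s⁻¹ : ℝ≥0)
  refine ⟨M, fun n hn => ?_⟩
  have hmin : ((s⁻¹ : ℝ≥0) : ℝ≥0∞) ≤ min a⁻¹ n := by
    refine le_min ?_ ?_
    · rw [ENNReal.coe_inv hs.ne', ENNReal.inv_le_inv]
      exact h.le
    · have : s⁻¹ ≤ (n : ℝ≥0) := hM.trans (by exact_mod_cast hn)
      exact_mod_cast this
  have h1 := ENNReal.toReal_mono (ne_top_of_le_ne_top (ENNReal.natCast_ne_top n)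
    (min_le_right a⁻¹ n)) hmin
  rw [ENNReal.coe_toReal, NNReal.coe_inv] at h1
  have h2 : (s : ℝ)⁻¹ ≤ increment a n := h1.trans (le_add_of_nonneg_right (by positivity))
  calc (1 : ℝ) = s * (s : ℝ)⁻¹ := (mul_inv_cancel₀ hs'.ne').symm
    _ ≤ _ := by gcongr

lemma eventually_mul_increment_le_one {a : ℝ≥0∞} {s : ℝ≥0} (h : s < a) :
    ∃ M : ℕ, ∀ n, M ≤ n → s * increment a n ≤ 1 := by
  obtain ⟨s', hss', hs'a⟩ := ENNReal.lt_iff_exists_nnreal_btwn.1 h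
  have hlt : s < s' := by exact_mod_cast hss'
  have hlt' : (s : ℝ) < s' := by exact_mod_cast hlt
  have hs0 : (0 : ℝ) ≤ s := s.coe_nonneg
  have hs' : 0 < s' := zero_le.trans_lt hlt
  have hs'' : (0 : ℝ) < s' := by exact_mod_cast hs'
  obtain ⟨M, hM⟩ := exists_nat_ge ((s : ℝ) * s' / (s' - s))
  -- The gap between s and s' absorbs the summand 1/(n+1) once n ≥ s s'/(s' - s).
  refine ⟨M, fun n hn => ?_⟩
  have hmin : min a⁻¹ n ≤ ((s'⁻¹ : ℝ≥0) : ℝ≥0∞) := by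
    refine (min_le_left _ _).trans ?_
    rw [ENNReal.coe_inv hs'.ne', ENNReal.inv_le_inv]
    exact hs'a.le
  have h1 := ENNReal.toReal_mono ENNReal.coe_ne_top hmin
  rw [ENNReal.coe_toReal, NNReal.coe_inv] at h1
  have hn' : (M : ℝ) ≤ n := by exact_mod_cast hn
  have h2 := hM.trans hn'
  rw [div_le_iff₀ (sub_pos.2 hlt')] at h2
  calc s * increment a n ≤ s * ((s' : ℝ)⁻¹ + 1 / (n + 1)) := by
        unfold increment
        gcongr
    _ ≤ 1 := by
        have h3 : (0 : ℝ) < n + 1 := by positivity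
        rw [show (s : ℝ) * ((s' : ℝ)⁻¹ + 1 / (n + 1)) = s * (n + 1 + s') / (s' * (n + 1)) by
          field_simp, div_le_one (by positivity)]
        nlinarith

/-- A function assigning a local dimension to every node of the binary tree. -/
structure LocalDim where
  D : (ℕ → Bool) → ℕ → ℝ≥0∞
  congr : ∀ {x y n}, x ∈ PiNat.cylinder y n → D x n = D y n

/-- The height function with given local dimensions. -/
def ofLocalDim (L : LocalDim) : TreeHeight where
  T x n := ∑ i ∈ Finset.range n, increment (L.D x i) i
  zero x := by simp
  mono x := monotone_nat_of_le_succ fun n => by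
    rw [Finset.sum_range_succ]
    exact le_add_of_nonneg_right (increment_pos _ _).le
  congr {x y n} hxy := Finset.sum_congr rfl fun i hi => by
    rw [L.congr (fun j hj => hxy j (hj.trans (Finset.mem_range.1 hi)))]
  unbounded C := by
    obtain ⟨n, hn⟩ := (Real.tendsto_sum_range_one_div_nat_succ_atTop.eventually_ge_atTop C).exists
    exact ⟨n, fun x => hn.trans (Finset.sum_le_sum fun i _ => one_div_le_increment _ _)⟩

variable {L : LocalDim}

lemma ofLocalDim_succ (x : ℕ → Bool) (n : ℕ) :
    (ofLocalDim L).T x (n + 1) = (ofLocalDim L).T x n + increment (L.D x n) n :=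
  Finset.sum_range_succ _ _

/-- Each level below M contributes an error of at most c. -/
lemma mul_sub_le_of_forall_le_increment {x : ℕ → Bool} {s c : ℝ} (hs : 0 ≤ s) (hc : 0 ≤ c)
    {m n M : ℕ} (hmn : m ≤ n)
    (hD : ∀ i, m ≤ i → i < n → M ≤ i → c ≤ s * increment (L.D x i) i) :
    c * (n - m) ≤ s * ((ofLocalDim L).T x n - (ofLocalDim L).T x m) + c * M := by
  induction n, hmn using Nat.le_induction with
  | base => simp; positivity
  | succ n hmn ih =>
    have ih' := ih fun i hi hin => hD i hi (hin.trans n.lt_succ_self)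
    have hinc := mul_nonneg hs (increment_pos (L.D x n) n).le
    rw [ofLocalDim_succ]
    push_cast
    rcases le_or_gt M n with hM | hM
    · have := hD n hmn n.lt_succ_self hM
      linarith
    · have h1 : ((n : ℝ) + 1) ≤ M := by exact_mod_cast hM
      have h2 := mul_nonneg hs (sub_nonneg.2 ((ofLocalDim L).mono x hmn))
      have h3 : c * (n + 1 - m) ≤ c * M := by
        gcongr
        linarith [(Nat.cast_nonneg m : (0 : ℝ) ≤ m)]
      linarith

/-- There are at most M exceptional levels, with increments at most M, whence the error s M². -/
lemma mul_sub_le_of_forall_increment_le {x : ℕ → Bool} {s c : ℝ} (hs : 0 ≤ s) (hc : 0 ≤ c)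
    {m n M : ℕ} (hmn : m ≤ n)
    (hD : ∀ i, m ≤ i → i < n → M ≤ i → s * increment (L.D x i) i ≤ c) :
    s * ((ofLocalDim L).T x n - (ofLocalDim L).T x m) ≤ c * (n - m) + s * (M * M) := by
  suffices s * ((ofLocalDim L).T x n - (ofLocalDim L).T x m) ≤
      c * (n - m) + s * (min n M * M : ℕ) by
    refine this.trans ?_
    gcongr
    exact_mod_cast Nat.mul_le_mul_right M (min_le_right n M)
  induction n, hmn using Nat.le_induction with
  | base => simp; positivity
  | succ n hmn ih =>
    have ih' := ih fun i hi hin => hD i hi (hin.trans n.lt_succ_self)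
    rw [ofLocalDim_succ]
    rcases le_or_gt M n with hM | hM
    · have := hD n hmn n.lt_succ_self hM
      rw [min_eq_right hM] at ih'
      rw [min_eq_right (hM.trans n.le_succ)]
      push_cast at ih' ⊢
      linarith
    · have h1 : ((n : ℝ) + 1) ≤ M := by exact_mod_cast hM
      rw [min_eq_left hM.le] at ih'
      rw [min_eq_left hM]
      push_cast at ih' ⊢
      have h2 : s * increment (L.D x n) n ≤ s * M := by
        gcongr
        exact (increment_le _ _).trans h1
      linarith

lemma ofLocalDim_le (x : ℕ → Bool) (n : ℕ) : (ofLocalDim L).T x n ≤ n * n := by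
  have := mul_sub_le_of_forall_increment_le (L := L) (x := x) (s := 1) (c := 0) zero_le_one le_rfl
    (M := n) (Nat.zero_le n) (fun i _ hi hi' => absurd hi (not_lt.2 hi'))
  rw [(ofLocalDim L).zero] at this
  linarith

end TreeHeight

/-! ### Alternating blocks and exit levels. -/

/-- A set of natural numbers such that both it and its complement contain long intervals. -/
lemma exists_alternating_blocks : ∃ E : ℕ → Prop,
    (∀ N, ∃ n, N ≤ n ∧ ∀ i, n ≤ i → i < n ^ 3 → E i) ∧
      ∀ N, ∃ n, N ≤ n ∧ ∀ i, n ≤ i → i < n ^ 3 → ¬ E i := by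
  have key (j i : ℕ) (h1 : 2 ^ 3 ^ j ≤ i) (h2 : i < (2 ^ 3 ^ j) ^ 3) :
      Nat.log 3 (Nat.log 2 i) = j := by
    have hi : i ≠ 0 := by
      have : 0 < 2 ^ 3 ^ j := by positivity
      omega
    rw [← pow_mul, ← pow_succ] at h2
    refine Nat.log_eq_of_pow_le_of_lt_pow ?_ ?_
    · exact Nat.le_log_of_pow_le one_lt_two h1
    · exact Nat.log_lt_of_lt_pow hi h2
  have hN (j : ℕ) : j ≤ 2 ^ 3 ^ j :=
    ((Nat.lt_pow_self (by norm_num)).trans (Nat.lt_pow_self (by norm_num))).le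
  -- The iterated logarithm is constant on [n, n³) for n = 2^(3^j), since cubing n raises j by one.
  -- Its parity alternates.
  refine ⟨fun i => Even (Nat.log 3 (Nat.log 2 i)), fun N => ⟨2 ^ 3 ^ (2 * N), ?_, ?_⟩,
    fun N => ⟨2 ^ 3 ^ (2 * N + 1), ?_, ?_⟩⟩
  · exact le_trans (by omega) (hN _)
  · intro i h1 h2
    simp [key _ i h1 h2]
  · exact le_trans (by omega) (hN _)
  · intro i h1 h2
    simp [key _ i h1 h2]

/-- The first position below `n` at which a binary sequence is `true`, or `n` if there is none. -/
def exitLevel (x : ℕ → Bool) (n : ℕ) : ℕ := sInf {k | n ≤ k ∨ x k = true}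

lemma exitLevel_le (x : ℕ → Bool) (n : ℕ) : exitLevel x n ≤ n := Nat.sInf_le (Or.inl le_rfl)

lemma eq_false_of_lt_exitLevel {x : ℕ → Bool} {n k : ℕ} (hk : k < exitLevel x n) :
    x k = false := by
  have := Nat.notMem_of_lt_sInf hk
  simp only [Set.mem_ofPred_eq, not_or] at this
  simpa using this.2

lemma apply_exitLevel {x : ℕ → Bool} {n : ℕ} (h : exitLevel x n < n) : x (exitLevel x n) = true :=
  (Nat.sInf_mem (s := {k | n ≤ k ∨ x k = true}) ⟨n, Or.inl le_rfl⟩).resolve_left (not_le.2 h)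

lemma exitLevel_eq_of_forall {x : ℕ → Bool} {n k : ℕ} (hkn : k ≤ n) (hk : k = n ∨ x k = true)
    (hlt : ∀ i < k, x i = false) : exitLevel x n = k := by
  refine le_antisymm (Nat.sInf_le (hk.imp (fun h => h.ge) id)) ?_
  by_contra! hc
  have h1 := apply_exitLevel (hc.trans_le hkn)
  rw [hlt _ hc] at h1
  exact Bool.false_ne_true h1

lemma exitLevel_of_le {x : ℕ → Bool} {n i : ℕ} (h : i ≤ exitLevel x n) : exitLevel x i = i :=
  exitLevel_eq_of_forall le_rfl (Or.inl rfl)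
    fun _ hj => eq_false_of_lt_exitLevel (hj.trans_le h)

lemma exitLevel_of_lt {x : ℕ → Bool} {n i : ℕ} (h : exitLevel x n < i) (hi : i ≤ n) :
    exitLevel x i = exitLevel x n :=
  exitLevel_eq_of_forall h.le (Or.inr (apply_exitLevel (h.trans_le hi)))
    fun _ hj => eq_false_of_lt_exitLevel hj

lemma exitLevel_congr {x y : ℕ → Bool} {n : ℕ} (hxy : x ∈ PiNat.cylinder y n) :
    exitLevel x n = exitLevel y n := by
  unfold exitLevel
  congr 1
  ext k
  simp only [Set.mem_ofPred_eq]
  rcases le_or_gt n k with hk | hk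
  · simp [hk]
  · rw [hxy k hk]

/-! ### The tree with four local dimensions. -/

namespace TreeHeight

open Classical in
/-- The local dimensions of a tree with four prescribed dimensions: next to a node at which a
branch leaves the constant branch `false`, there are a short `a₄`-dimensional part and a long
`a₃`-dimensional one, after which `a₁`- and `a₂`-dimensional parts alternate. -/
def fourDim (E : ℕ → Prop) (a₁ a₂ a₃ a₄ : ℝ≥0∞) : LocalDim where
  D x n :=
    if n ≤ exitLevel x n then 0
    else if n ≤ 2 * exitLevel x n then a₄
    else if n < (exitLevel x n + 2) ^ 4 then a₃
    else if E n then a₂ else a₁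
  congr hxy := by rw [exitLevel_congr hxy]

section

variable {E : ℕ → Prop} {a₁ a₂ a₃ a₄ : ℝ≥0∞} {x : ℕ → Bool} {n : ℕ}

lemma fourDim_of_le (h : n ≤ exitLevel x n) : (fourDim E a₁ a₂ a₃ a₄).D x n = 0 := by
  simp [fourDim, h]

lemma fourDim_of_le_two_mul (h : exitLevel x n < n) (h' : n ≤ 2 * exitLevel x n) :
    (fourDim E a₁ a₂ a₃ a₄).D x n = a₄ := by
  simp [fourDim, not_le.2 h, h']

lemma fourDim_of_lt_pow (h : 2 * exitLevel x n < n) (h' : n < (exitLevel x n + 2) ^ 4) :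
    (fourDim E a₁ a₂ a₃ a₄).D x n = a₃ := by
  simp [fourDim, not_le.2 h, show ¬ n ≤ exitLevel x n by omega, h']

/-- The shift by 2 makes the a₃-dimensional range nonempty even for k = 0. -/
lemma two_mul_lt_pow (k : ℕ) : 2 * k + 1 < (k + 2) ^ 4 := by
  have h1 : (k + 2) ^ 2 ≤ (k + 2) ^ 4 := Nat.pow_le_pow_right (by omega) (by norm_num)
  nlinarith

lemma fourDim_of_pow_le (h : (exitLevel x n + 2) ^ 4 ≤ n) [Decidable (E n)] :
    (fourDim E a₁ a₂ a₃ a₄).D x n = if E n then a₂ else a₁ := by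
  have := two_mul_lt_pow (exitLevel x n)
  simp only [fourDim, not_le.2 (show exitLevel x n < n by omega),
    not_le.2 (show 2 * exitLevel x n < n by omega), not_lt.2 h, if_false]
  congr

lemma fourDim_le_of_two_mul_lt (h₁₂ : a₁ ≤ a₂) (h₂₃ : a₂ ≤ a₃) (h : 2 * exitLevel x n < n) :
    (fourDim E a₁ a₂ a₃ a₄).D x n ≤ a₃ := by
  classical
  rcases lt_or_ge n ((exitLevel x n + 2) ^ 4) with h' | h'
  · exact (fourDim_of_lt_pow h h').le
  · rw [fourDim_of_pow_le h']
    split_ifs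
    · exact h₂₃
    · exact h₁₂.trans h₂₃

lemma fourDim_le (h₁₂ : a₁ ≤ a₂) (h₂₃ : a₂ ≤ a₃) (h₃₄ : a₃ ≤ a₄) :
    (fourDim E a₁ a₂ a₃ a₄).D x n ≤ a₄ := by
  rcases le_or_gt n (exitLevel x n) with h | h
  · rw [fourDim_of_le h]
    exact zero_le
  rcases le_or_gt n (2 * exitLevel x n) with h' | h'
  · exact (fourDim_of_le_two_mul h h').le
  · exact (fourDim_le_of_two_mul_lt h₁₂ h₂₃ h').trans h₃₄

/-- Along each branch, the local dimensions eventually are the alternating ones, except for the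
constant branch. -/
lemma exists_forall_fourDim_eq (E : ℕ → Prop) [DecidablePred E] (a₁ a₂ a₃ a₄ : ℝ≥0∞)
    {x : ℕ → Bool} (hx : x ≠ fun _ => false) :
    ∃ N, ∀ i, N ≤ i → (fourDim E a₁ a₂ a₃ a₄).D x i = if E i then a₂ else a₁ := by
  classical
  have hex : ∃ k, x k = true := by
    by_contra! hc
    exact hx (funext fun k => by simpa using hc k)
  refine ⟨(Nat.find hex + 2) ^ 4, fun i hi => fourDim_of_pow_le ?_⟩
  have := two_mul_lt_pow (Nat.find hex)
  rwa [exitLevel_eq_of_forall (k := Nat.find hex) (by omega) (Or.inr (Nat.find_spec hex))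
    fun j hj => by simpa using Nat.find_min hex hj]

lemma exitLevel_const_false (n : ℕ) : exitLevel (fun _ => false) n = n :=
  exitLevel_eq_of_forall le_rfl (Or.inl rfl) fun _ _ => rfl

end

/-! ### The dimensions of this tree. -/

section

variable {E : ℕ → Prop} {a₁ a₂ a₃ a₄ : ℝ≥0∞}

lemma assouadDim_fourDim_le (h₁₂ : a₁ ≤ a₂) (h₂₃ : a₂ ≤ a₃) (h₃₄ : a₃ ≤ a₄) {s : ℝ≥0}
    (hs : a₄ < s) : assouadDim (ofLocalDim (fourDim E a₁ a₂ a₃ a₄)).Boundary ≤ s := by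
  obtain ⟨M, hM⟩ := eventually_one_le_mul_increment hs
  refine assouadDim_le (C := M) (by exact_mod_cast zero_le.trans_lt hs) fun x m n hmn => ?_
  have := mul_sub_le_of_forall_le_increment (L := fourDim E a₁ a₂ a₃ a₄) (x := x) (M := M)
    s.coe_nonneg zero_le_one hmn fun i _ _ hi => (hM i hi).trans
      (mul_le_mul_of_nonneg_left (increment_anti (fourDim_le h₁₂ h₂₃ h₃₄) i) s.coe_nonneg)
  linarith

lemma upperBoxDim_fourDim_le (h₁₂ : a₁ ≤ a₂) (h₂₃ : a₂ ≤ a₃) {s : ℝ≥0} (hs : a₃ < s) :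
    upperBoxDim (ofLocalDim (fourDim E a₁ a₂ a₃ a₄)).Boundary ≤ ((s : ℝ) : EReal) := by
  have hs0 : (0 : ℝ) < s := by exact_mod_cast (zero_le (a := a₃)).trans_lt hs
  obtain ⟨M₁, hM₁⟩ := eventually_one_le_mul_increment hs
  obtain ⟨M₂, hM₂⟩ := exists_nat_ge (2 / (s : ℝ))
  refine upperBoxDim_le (C := 2 * M₂ + M₁ + 1) fun x n => ?_
  set k := exitLevel x n with hk
  have hkn : k ≤ n := exitLevel_le x n
  set h := ofLocalDim (fourDim E a₁ a₂ a₃ a₄) with hh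
  -- Before the exit, each level from M₂ on has s times its increment at least 2. It thus pays for
  -- two levels, and the surplus covers the a₄-dimensional part up to 2k.
  have h1 : 2 * ((k : ℝ) - (0 : ℕ)) ≤ s * (h.T x k - h.T x 0) + 2 * M₂ := by
    refine mul_sub_le_of_forall_le_increment hs0.le zero_le_two (Nat.zero_le k) ?_
    intro i _ hik hi
    rw [fourDim_of_le (exitLevel_of_le hik.le).ge]
    calc (2 : ℝ) = s * (2 / s) := by field_simp
      _ ≤ s * i := by
        gcongr
        exact hM₂.trans (by exact_mod_cast hi)
      _ ≤ _ := by
        gcongr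
        exact le_increment_zero i
  rw [h.zero] at h1
  push_cast at h1
  rcases le_or_gt n (2 * k + 1) with hn | hn
  · have h2 : (n : ℝ) ≤ 2 * k + 1 := by exact_mod_cast hn
    have h3 := mul_le_mul_of_nonneg_left (h.mono x hkn) hs0.le
    linarith [(Nat.cast_nonneg M₁ : (0 : ℝ) ≤ M₁)]
  · have h2 : 1 * ((n : ℝ) - (2 * k + 1 : ℕ)) ≤ s * (h.T x n - h.T x (2 * k + 1)) + 1 * M₁ := by
      refine mul_sub_le_of_forall_le_increment hs0.le zero_le_one hn.le ?_
      intro i hki hin hi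
      refine (hM₁ i hi).trans (mul_le_mul_of_nonneg_left (increment_anti ?_ i) hs0.le)
      refine fourDim_le_of_two_mul_lt h₁₂ h₂₃ ?_
      rw [exitLevel_of_lt (n := n) (by omega) hin.le]
      omega
    have h3 := mul_le_mul_of_nonneg_left (h.mono x (show k ≤ 2 * k + 1 by omega)) hs0.le
    push_cast at h2
    linarith

lemma packingDim_fourDim_le (h₁₂ : a₁ ≤ a₂) {s : ℝ≥0} (hs : a₂ < s) :
    packingDim (ofLocalDim (fourDim E a₁ a₂ a₃ a₄)).Boundary ≤ s := by
  classical
  obtain ⟨M, hM⟩ := eventually_one_le_mul_increment hs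
  refine packingDim_le fun x => ?_
  obtain ⟨N, hN⟩ : ∃ N, ∀ i, N ≤ i → (fourDim E a₁ a₂ a₃ a₄).D x i ≤ a₂ := by
    by_cases hx : x = fun _ => false
    · refine ⟨0, fun i _ => ?_⟩
      rw [hx, fourDim_of_le (exitLevel_const_false i).ge]
      exact zero_le
    · obtain ⟨N, hN⟩ := exists_forall_fourDim_eq E a₁ a₂ a₃ a₄ hx
      refine ⟨N, fun i hi => ?_⟩
      rw [hN i hi]
      split_ifs
      · exact le_rfl
      · exact h₁₂
  refine ⟨(max M N : ℕ), fun n => ?_⟩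
  have := mul_sub_le_of_forall_le_increment (L := fourDim E a₁ a₂ a₃ a₄) (x := x) (M := max M N)
    s.coe_nonneg zero_le_one (Nat.zero_le n) fun i _ _ hi =>
      (hM i ((le_max_left _ _).trans hi)).trans (mul_le_mul_of_nonneg_left
        (increment_anti (hN i ((le_max_right _ _).trans hi)) i) s.coe_nonneg)
  rw [(ofLocalDim _).zero] at this
  push_cast at this ⊢
  linarith

lemma dimH_fourDim_le (hE : ∀ N, ∃ n, N ≤ n ∧ ∀ i, n ≤ i → i < n ^ 3 → ¬ E i) {s : ℝ≥0}
    (hs : a₁ < s) :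
    dimH (Set.univ : Set (ofLocalDim (fourDim E a₁ a₂ a₃ a₄)).Boundary) ≤ s := by
  classical
  obtain ⟨s', hs', hs's⟩ := ENNReal.lt_iff_exists_nnreal_btwn.1 hs
  have hlt : (s' : ℝ) < s := by exact_mod_cast hs's
  have hs0 : (0 : ℝ) < s' := by exact_mod_cast (zero_le (a := a₁)).trans_lt hs'
  obtain ⟨M, hM⟩ := eventually_one_le_mul_increment hs'
  set L := fourDim E a₁ a₂ a₃ a₄ with hL
  refine dimH_univ_le (by exact_mod_cast hs0.trans hlt)
    -- With ≤ instead of equality these sets also contain the constant branch, whose local dimension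
    -- is 0.
    (fun N => {x | ∀ i, N ≤ i → L.D x i ≤ if E i then a₂ else a₁}) ?_ ?_
  · refine Set.eq_univ_of_forall fun x => Set.mem_iUnion.2 ?_
    by_cases hx : x = fun _ => false
    · refine ⟨0, fun i _ => ?_⟩
      rw [hx, hL, fourDim_of_le (exitLevel_const_false i).ge]
      exact zero_le
    · obtain ⟨N, hN⟩ := exists_forall_fourDim_eq E a₁ a₂ a₃ a₄ hx
      exact ⟨N, fun i hi => (hN i hi).le⟩
  · intro N C
    -- With n ≥ K, the surplus (s - s') n³ dominates the lower-order terms, each bounded by a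
    -- multiple of n².
    obtain ⟨K, hK⟩ := exists_nat_ge ((s + s * M + s' * |C|) / (s - s') : ℝ)
    obtain ⟨n, hn, hnE⟩ := hE (max (max N K) 1)
    have hNn : N ≤ n := (le_max_left _ _).trans ((le_max_left _ _).trans hn)
    have hKn : (K : ℝ) ≤ n := by exact_mod_cast (le_max_right N _).trans ((le_max_left _ _).trans hn)
    have h1n : (1 : ℝ) ≤ n := by exact_mod_cast (le_max_right _ _).trans hn
    refine ⟨n ^ 3, fun y hy => ?_⟩
    have h1 := mul_sub_le_of_forall_le_increment (L := L) (x := y) (M := M) (s := s') hs0.le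
      zero_le_one (Nat.le_self_pow three_ne_zero n) fun i hni hin hi => by
        have := hy i (hNn.trans hni)
        rw [if_neg (hnE i hni hin)] at this
        exact (hM i hi).trans (mul_le_mul_of_nonneg_left (increment_anti this i) hs0.le)
    have h2 := (ofLocalDim L).nonneg y n
    have h3 : (n : ℝ) ^ 3 - n - M ≤ s' * (ofLocalDim L).T y (n ^ 3) := by
      push_cast at h1
      nlinarith
    have h4 := (div_le_iff₀ (sub_pos.2 hlt)).1 (hK.trans hKn)
    have h5 : s' * ((n : ℝ) ^ 3 + C) ≤ s * ((n : ℝ) ^ 3 - n - M) := by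
      have hB : (0 : ℝ) ≤ s * M + s' * |C| := by positivity
      have h6 : (s + s * M + s' * |C|) * (n : ℝ) ^ 2 ≤ n * (s - s') * (n : ℝ) ^ 2 := by gcongr
      have h7 : (n : ℝ) ≤ (n : ℝ) ^ 2 := by nlinarith
      have h8 : s * (n : ℝ) ≤ s * (n : ℝ) ^ 2 := by gcongr
      have h9 : (s * M + s' * |C|) * 1 ≤ (s * M + s' * |C|) * (n : ℝ) ^ 2 := by
        gcongr
        nlinarith
      have h10 : s' * C ≤ s' * |C| := by
        gcongr
        exact le_abs_self C
      nlinarith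
    have h11 : s * ((n : ℝ) ^ 3 - n - M) ≤ s * (s' * (ofLocalDim L).T y (n ^ 3)) := by gcongr
    have h12 : s' * ((n : ℝ) ^ 3 + C) ≤ s' * (s * (ofLocalDim L).T y (n ^ 3)) := by linarith
    push_cast
    exact le_of_mul_le_mul_left h12 hs0

lemma le_dimH_fourDim (h₁₂ : a₁ ≤ a₂) {s : ℝ≥0} (hs : s < a₁) :
    s ≤ dimH (Set.univ : Set (ofLocalDim (fourDim E a₁ a₂ a₃ a₄)).Boundary) := by
  classical
  rcases eq_zero_or_pos s with rfl | hs0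
  · simp
  obtain ⟨M, hM⟩ := eventually_mul_increment_le_one hs
  refine le_dimH_univ hs0 ((Set.countable_singleton (fun _ => false)).mono fun x hx => ?_)
  by_contra hne
  apply hx
  obtain ⟨N, hN⟩ := exists_forall_fourDim_eq E a₁ a₂ a₃ a₄ hne
  refine ⟨s * ((max M N : ℕ) * (max M N : ℕ)), fun n => ?_⟩
  have := mul_sub_le_of_forall_increment_le (L := fourDim E a₁ a₂ a₃ a₄) (x := x) (M := max M N)
    s.coe_nonneg zero_le_one (Nat.zero_le n) fun i _ _ hi => by
      refine le_trans (mul_le_mul_of_nonneg_left (increment_anti (a := a₁) ?_ i) s.coe_nonneg)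
        (hM i ((le_max_left _ _).trans hi))
      rw [hN i ((le_max_right _ _).trans hi)]
      split_ifs
      · exact h₁₂
      · exact le_rfl
  rw [(ofLocalDim _).zero] at this
  push_cast at this ⊢
  linarith

lemma le_packingDim_fourDim (hE : ∀ N, ∃ n, N ≤ n ∧ ∀ i, n ≤ i → i < n ^ 3 → E i) {s : ℝ≥0}
    (hs : s < a₂) : s ≤ packingDim (ofLocalDim (fourDim E a₁ a₂ a₃ a₄)).Boundary := by
  classical
  obtain ⟨s', hss', hs'⟩ := ENNReal.lt_iff_exists_nnreal_btwn.1 hs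
  have hlt : (s : ℝ) < s' := by exact_mod_cast hss'
  have hs0 : (0 : ℝ) ≤ s := s.coe_nonneg
  have hs'0 : (0 : ℝ) < s' := hs0.trans_lt hlt
  obtain ⟨M, hM⟩ := eventually_mul_increment_le_one hs'
  set L := fourDim E a₁ a₂ a₃ a₄ with hL
  -- Branches starting with `true` have exit level 0, which gives height bounds uniform on a
  -- cylinder.
  refine le_iSup₂_of_le s (packingMeasure_univ_eq_top (fun _ => true) 1 fun C => ?_) le_rfl
  obtain ⟨K, hK⟩ := exists_nat_ge ((s' * (s + s * (M * M) + |C|)) / (s' - s) : ℝ)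
  obtain ⟨n, hn, hnE⟩ := hE (max (max 16 K) 1)
  -- 16 is (k+2)^4 at k = 0, where the alternating blocks begin.
  have h16 : 16 ≤ n := (le_max_left _ _).trans ((le_max_left _ _).trans hn)
  have hKn : (K : ℝ) ≤ n := by exact_mod_cast (le_max_right _ _).trans ((le_max_left _ _).trans hn)
  have h1n : (1 : ℝ) ≤ n := by exact_mod_cast (le_max_right _ _).trans hn
  -- Heights at level n are at most n², negligible against the n³/s' allowed for the block.
  refine ⟨n ^ 3, n * n + M * M + n ^ 3 / s', fun y hy => ?_, ?_⟩
  · have h1 := mul_sub_le_of_forall_increment_le (L := L) (x := y) (M := M) (s := s') hs'0.le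
      zero_le_one (Nat.le_self_pow three_ne_zero n) fun i hni hin hi => by
        have hexit : exitLevel y i = 0 := exitLevel_eq_of_forall (Nat.zero_le i)
          (Or.inr (hy 0 one_pos)) fun j hj => absurd hj (Nat.not_lt_zero j)
        have hD : L.D y i = a₂ :=
          (fourDim_of_pow_le (by rw [hexit]; omega)).trans (if_pos (hnE i hni hin))
        exact (congrArg (fun a => s' * increment a i) hD).trans_le (hM i hi)
    have h2 := ofLocalDim_le (L := L) y n
    have h3 : s' * (ofLocalDim L).T y (n ^ 3) ≤ s' * (n * n + M * M + n ^ 3 / s') := by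
      rw [mul_add, mul_div_cancel₀ _ hs'0.ne']
      push_cast at h1
      nlinarith
    exact le_of_mul_le_mul_left h3 hs'0
  · have h4 := (div_le_iff₀ (sub_pos.2 hlt)).1 (hK.trans hKn)
    push_cast
    have hn2 : (1 : ℝ) ≤ (n : ℝ) ^ 2 := by nlinarith
    have h5 : s' * (s + s * (M * M) + |C|) * (n : ℝ) ^ 2 ≤ n * (s' - s) * (n : ℝ) ^ 2 := by gcongr
    have h6 : (s * (M * M) + |C|) * 1 ≤ (s * (M * M) + |C|) * (n : ℝ) ^ 2 := by gcongr
    have h7 : s' * ((s * (M * M) + |C|) * 1) ≤ s' * ((s * (M * M) + |C|) * (n : ℝ) ^ 2) := by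
      gcongr
    have h8 : s' * C ≤ s' * |C| := by
      gcongr
      exact le_abs_self C
    have h9 : s' * (s * (n * n + M * M + n ^ 3 / s') + C) ≤ s' * (n : ℝ) ^ 3 := by
      have : s' * (s * (n * n + M * M + n ^ 3 / s') + C) =
          s' * (s * n ^ 2 + s * (M * M) + C) + s * (n : ℝ) ^ 3 := by
        field_simp
        ring
      rw [this]
      nlinarith
    exact le_of_mul_le_mul_left h9 hs'0

/-- The branch that leaves the constant branch `false` at level `k`. -/
def exitBranch (k : ℕ) : ℕ → Bool := fun i => decide (k ≤ i)

lemma exitLevel_of_mem_cylinder {k : ℕ} {y : ℕ → Bool}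
    (hy : y ∈ PiNat.cylinder (exitBranch k) (k + 1)) {i : ℕ} (hi : k < i) : exitLevel y i = k := by
  refine exitLevel_eq_of_forall hi.le (Or.inr ?_) fun j hj => ?_
  · rw [hy k k.lt_succ_self]
    simp [exitBranch]
  · rw [hy j (hj.trans k.lt_succ_self)]
    simp [exitBranch, hj]

/-- Approximation from below says nothing when a₃ = 0, while values in `EReal` might be negative. -/
lemma zero_le_upperBoxDim : 0 ≤ upperBoxDim (ofLocalDim (fourDim E a₁ a₂ a₃ a₄)).Boundary := by
  have := le_upperBoxDim (h := ofLocalDim (fourDim E a₁ a₂ a₃ a₄)) (s := 0) fun C => by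
    obtain ⟨n, hn⟩ := exists_nat_ge C
    exact ⟨fun _ => false, 0, n, n * n, Nat.zero_le n, fun y _ => ofLocalDim_le y n, by simpa⟩
  simpa using this

lemma le_upperBoxDim_fourDim {s : ℝ≥0} (hs : s < a₃) :
    ((s : ℝ) : EReal) ≤ upperBoxDim (ofLocalDim (fourDim E a₁ a₂ a₃ a₄)).Boundary := by
  obtain ⟨s', hss', hs'⟩ := ENNReal.lt_iff_exists_nnreal_btwn.1 hs
  have hlt : (s : ℝ) < s' := by exact_mod_cast hss'
  have hs0 : (0 : ℝ) ≤ s := s.coe_nonneg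
  have hs'0 : (0 : ℝ) < s' := hs0.trans_lt hlt
  obtain ⟨M, hM⟩ := eventually_mul_increment_le_one hs'
  set L := fourDim E a₁ a₂ a₃ a₄ with hL
  refine le_upperBoxDim fun C => ?_
  -- With κ = k + 2, the three terms bound s(2k+1)², k + 1 and C by multiples of κ². The gain (s' -
  -- s)κ⁴ outweighs them.
  obtain ⟨K, hK⟩ := exists_nat_ge ((s' * (4 * s + 1 + |C|)) / (s' - s) : ℝ)
  set k := max M K
  have hMk : M ≤ k := le_max_left _ _
  have hKk : (K : ℝ) ≤ k := by exact_mod_cast le_max_right M K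
  have hkn : 2 * k + 1 ≤ (k + 2) ^ 4 := (two_mul_lt_pow k).le
  refine ⟨exitBranch k, k + 1, (k + 2) ^ 4, (2 * k + 1) * (2 * k + 1) + (k + 2) ^ 4 / s',
    by omega, fun y hy => ?_, ?_⟩
  · have h1 := mul_sub_le_of_forall_increment_le (L := L) (x := y) (M := 0) (s := s') hs'0.le
      zero_le_one hkn fun i hki hin _ => by
        have hexit : exitLevel y i = k := exitLevel_of_mem_cylinder hy (by omega)
        have hD : L.D y i = a₃ :=
          fourDim_of_lt_pow (by rw [hexit]; omega) (by rwa [hexit])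
        exact (congrArg (fun a => s' * increment a i) hD).trans_le (hM i (by omega))
    have h2 := ofLocalDim_le (L := L) y (2 * k + 1)
    have h3 : s' * (ofLocalDim L).T y ((k + 2) ^ 4) ≤
        s' * ((2 * k + 1) * (2 * k + 1) + (k + 2) ^ 4 / s') := by
      rw [mul_add, mul_div_cancel₀ _ hs'0.ne']
      push_cast at h1 h2
      nlinarith
    exact le_of_mul_le_mul_left h3 hs'0
  · have h4 := (div_le_iff₀ (sub_pos.2 hlt)).1 (hK.trans hKk)
    push_cast
    have hk0 : (0 : ℝ) ≤ k := k.cast_nonneg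
    set κ : ℝ := (k : ℝ) + 2 with hκ
    have hκ1 : 1 ≤ κ ^ 2 := by nlinarith
    have h5 : (4 * s + 1 + |C|) * s' * κ ^ 2 ≤ k * (s' - s) * κ ^ 2 :=
      mul_le_mul_of_nonneg_right (by linarith) (sq_nonneg κ)
    have h6 : (s' - s) * κ ^ 2 * k ≤ (s' - s) * κ ^ 2 * κ ^ 2 := by
      have : 0 ≤ (s' : ℝ) - s := (sub_pos.2 hlt).le
      gcongr
      nlinarith
    have h7 : s * ((2 * k + 1) * (2 * k + 1) : ℝ) ≤ s * (4 * κ ^ 2) :=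
      mul_le_mul_of_nonneg_left (by nlinarith) hs0
    have h8 : C ≤ |C| * κ ^ 2 :=
      (le_abs_self C).trans (le_mul_of_one_le_right (abs_nonneg C) hκ1)
    have h9 : (k : ℝ) + 1 ≤ κ ^ 2 := by nlinarith
    have h10 : s' * (s * ((2 * k + 1) * (2 * k + 1)) + C + (k + 1)) ≤
        s' * ((4 * s + 1 + |C|) * κ ^ 2) := by
      gcongr
      linarith
    have h11 : s' * (s * ((2 * k + 1) * (2 * k + 1) + κ ^ 4 / s') + C) =
        s' * (s * ((2 * k + 1) * (2 * k + 1)) + C) + s * κ ^ 4 := by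
      field_simp
      ring
    have h12 : s' * (s * ((2 * k + 1) * (2 * k + 1) + κ ^ 4 / s') + C) ≤
        s' * (κ ^ 4 - (k + 1)) := by
      rw [h11]
      linarith
    exact le_of_mul_le_mul_left h12 hs'0

lemma le_assouadDim_fourDim {s : ℝ≥0} (hs : s < a₄) :
    s ≤ assouadDim (ofLocalDim (fourDim E a₁ a₂ a₃ a₄)).Boundary := by
  obtain ⟨s', hss', hs'⟩ := ENNReal.lt_iff_exists_nnreal_btwn.1 hs
  have hlt : (s : ℝ) < s' := by exact_mod_cast hss'
  have hs0 : (0 : ℝ) ≤ s := s.coe_nonneg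
  have hs'0 : (0 : ℝ) < s' := hs0.trans_lt hlt
  obtain ⟨M, hM⟩ := eventually_mul_increment_le_one hs'
  set L := fourDim E a₁ a₂ a₃ a₄ with hL
  refine le_assouadDim fun C => ?_
  obtain ⟨K, hK⟩ := exists_nat_ge (s' * C / (s' - s) : ℝ)
  set k := max M K
  have hMk : M ≤ k := le_max_left _ _
  have hKk : (K : ℝ) ≤ k := by exact_mod_cast le_max_right M K
  -- Exactly the k levels k+1, ..., 2k have local dimension a₄ below this node, and k ≥ M puts them
  -- all past the threshold.
  refine ⟨exitBranch k, k + 1, 2 * k + 1, k / s', by omega, by positivity, fun y hy => ?_, ?_⟩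
  · have h1 := mul_sub_le_of_forall_increment_le (L := L) (x := y) (M := 0) (s := s') hs'0.le
      zero_le_one (show k + 1 ≤ 2 * k + 1 by omega) fun i hki hin _ => by
        have hexit : exitLevel y i = k := exitLevel_of_mem_cylinder hy (by omega)
        have hD : L.D y i = a₄ :=
          fourDim_of_le_two_mul (by rw [hexit]; omega) (by rw [hexit]; omega)
        exact (congrArg (fun a => s' * increment a i) hD).trans_le (hM i (by omega))
    rw [(ofLocalDim L).congr hy] at h1
    have h3 : s' * (ofLocalDim L).T y (2 * k + 1) ≤
        s' * ((ofLocalDim L).T (exitBranch k) (k + 1) + k / s') := by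
      rw [mul_add, mul_div_cancel₀ _ hs'0.ne']
      push_cast at h1
      linarith
    exact le_of_mul_le_mul_left h3 hs'0
  · have h4 := (div_le_iff₀ (sub_pos.2 hlt)).1 (hK.trans hKk)
    have h5 : s' * (s * (k / s') + C) ≤ s' * k := by
      have : s' * (s * (k / s') + C) = s * (k : ℝ) + s' * C := by field_simp
      rw [this]
      linarith
    push_cast
    linarith [le_of_mul_le_mul_left h5 hs'0]

end

end TreeHeight

/-! ### Equality from strict bounds, and the conclusion. -/

lemma ENNReal.eq_of_forall_nnreal {a b : ℝ≥0∞} (h₁ : ∀ s : ℝ≥0, s < a → s ≤ b)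
    (h₂ : ∀ s : ℝ≥0, a < s → b ≤ s) : b = a := by
  refine le_antisymm ?_ (ENNReal.le_of_forall_nnreal_lt h₁)
  by_contra! hlt
  obtain ⟨s, hs, hsb⟩ := ENNReal.lt_iff_exists_nnreal_btwn.1 hlt
  exact absurd (h₂ s hs) (not_le.2 hsb)

lemma EReal.eq_coe_of_forall_nnreal {a : ℝ≥0∞} {b : EReal} (hb : 0 ≤ b)
    (h₁ : ∀ s : ℝ≥0, s < a → ((s : ℝ) : EReal) ≤ b)
    (h₂ : ∀ s : ℝ≥0, a < s → b ≤ ((s : ℝ) : EReal)) : b = (a : EReal) := by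
  lift b to ℝ≥0∞ using hb
  have hcoe (s : ℝ≥0) : ((s : ℝ) : EReal) = ((s : ℝ≥0∞) : EReal) := rfl
  simp only [hcoe, EReal.coe_ennreal_le_coe_ennreal_iff] at h₁ h₂
  rw [ENNReal.eq_of_forall_nnreal h₁ h₂]

end

theorem theorem1p1 (a₁ a₂ a₃ a₄ : ℝ≥0∞) (h₁₂ : a₁ ≤ a₂) (h₂₃ : a₂ ≤ a₃) (h₃₄ : a₃ ≤ a₄) :
    ∃ (X : Type) (_ : MetricSpace X),
      IsUltrametricDist X ∧ Nonempty (X ≃ₜ cantorSet) ∧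
        dimH (Set.univ : Set X) = a₁ ∧ packingDim X = a₂ ∧
          upperBoxDim X = (a₃ : EReal) ∧ assouadDim X = a₄ := by
  obtain ⟨E, hE, hE'⟩ := exists_alternating_blocks
  let h := TreeHeight.ofLocalDim (TreeHeight.fourDim E a₁ a₂ a₃ a₄)
  refine ⟨h.Boundary, inferInstance, inferInstance,
    ⟨h.boundaryHomeo.symm.trans cantorSetHomeomorphNatToBool.symm⟩, ?_, ?_, ?_, ?_⟩
  · exact ENNReal.eq_of_forall_nnreal (fun s hs => TreeHeight.le_dimH_fourDim h₁₂ hs)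
      fun s hs => TreeHeight.dimH_fourDim_le hE' hs
  · exact ENNReal.eq_of_forall_nnreal (fun s hs => TreeHeight.le_packingDim_fourDim hE hs)
      fun s hs => TreeHeight.packingDim_fourDim_le h₁₂ hs
  · exact EReal.eq_coe_of_forall_nnreal TreeHeight.zero_le_upperBoxDim
      (fun s hs => TreeHeight.le_upperBoxDim_fourDim hs)
      fun s hs => TreeHeight.upperBoxDim_fourDim_le h₁₂ h₂₃ hs
  · exact ENNReal.eq_of_forall_nnreal (fun s hs => TreeHeight.le_assouadDim_fourDim hs)
      fun s hs => TreeHeight.assouadDim_fourDim_le h₁₂ h₂₃ h₃₄ hs
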